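/- Let $S$ be a quantum system of finite dimension $d_S$ with orthonormal basis $(|i\rangle)$, interacting in the quantum measurement limit with finitely many finite-dimensional environments. The environments are split into $m=fM$ observed ones and $l=(1-f)M$ discarded ones. The initial state is a product $\varrho(0)=\varrho_S(0)\otimes\bigotimes_k\varrho^{(k)}(0)$ of density matrices. The evolution is $U(t)=\sum_i|i\rangle\langle i|\otimes\bigotimes_k U_i^{(k)}(t)$, where $U_i^{(k)}(t)=\exp(-i\,a_iB_kt)$ with real $a_i$ and Hermitian $B_k$. Let $\varrho^{(fM)}(t)$ be the partial trace of $U(t)\varrho(0)U(t)^\dagger$ over the discarded environments. Put $$\sigma_{ij}=\langle i|\varrho_S(0)|j\rangle,\quad \sigma_i=\sigma_{ii},\quad \varrho_{i,j}^{(k)}(t)=U_i^{(k)}(t)\varrho^{(k)}(0)U_j^{(k)}(t)^\dagger,\quad \varrho_i^{(k)}(t)=\varrho_{i,i}^{(k)}(t),$$ $$\Gamma(t)=\sum_{i\ne j}|\sigma_{ij}|\prod_{k\ \text{discarded}}\bigl|\operatorname{Tr}\varrho_{i,j}^{(k)}(t)\bigr| .$$ Let $\mathsf P=\{P_i^{(k)}\}$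 consist, for each observed environment $k$, of a complete set of mutually orthogonal (possibly zero) projectors indexed by $i=1,\dots,d_S$. Put $p_i^{(k)}=\operatorname{Tr}[P_i^{(k)}\varrho_i^{(k)}(t)P_i^{(k)}]$ and $r_i=\prod_{k\ \text{observed}}p_i^{(k)}$. If $\sum_j\sigma_jr_j>0$, let $$\varrho_{SBS}^{(fM)}(t;\mathsf P)=\sum_i\frac{\sigma_ir_i}{\sum_j\sigma_jr_j}\,|i\rangle\langle i|\otimes\bigotimes_{k\ \text{observed}}\frac{P_i^{(k)}\varrho_i^{(k)}(t)P_i^{(k)}}{p_i^{(k)}},$$ where terms with $\sigma_ir_i=0$ are omitted. Then, for every $t$, the minimum over all $\mathsf P$ for which $\varrho_{SBS}^{(fM)}(t;\mathsf P)$ is defined is attained, and $$\frac12\min_{\mathsf P}\bigl\|\varrho^{(fM)}(t)-\varrho_{SBS}^{(fM)}(t;\mathsf P)\bigr\|_1\le\eta:=\Gamma(t)+\sum_{i\neq j}\sqrt{\sigma_i\sigma_j}\sum_{k\ \text{observed}}B\bigl(\varrho_i^{(k)}(t),\varrho_j^{(k)}(t)\bigr),$$ where $\|X\|_1=\operatorname{Tr}\sqrt{X^\dagger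 X}$ and $B(\varrho,\sigma)=\|\sqrt\varrho\sqrt\sigma\|_1$. Sums over $i\ne j$ run over ordered pairs. -/

import Mathlib

open Matrix
open scoped Kronecker ComplexOrder MatrixOrder

noncomputable section

namespace SBS

/-! ### Matrices and states -/

/-- A density matrix (quantum state): positive semidefinite with unit trace. -/
structure IsDensity {ι : Type*} [Fintype ι] (ρ : Matrix ι ι ℂ) : Prop where
  posSemidef : ρ.PosSemidef
  trace_eq_one : ρ.trace = 1

/-- The trace norm `‖X‖₁ = Tr √(X† X)`. -/
def traceNorm {ι : Type*} [Fintype ι] [DecidableEq ι] (X : Matrix ι ι ℂ) : ℝ :=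
  (CFC.sqrt (Xᴴ * X)).trace.re

/-- The fidelity `B(ρ, σ) = ‖√ρ √σ‖₁`. -/
def fidelity {ι : Type*} [Fintype ι] [DecidableEq ι] (ρ σ : Matrix ι ι ℂ) : ℝ :=
  traceNorm (CFC.sqrt ρ * CFC.sqrt σ)

/-- The tensor product `⨂ₖ Xₖ` of a finite family of matrices, acting on the tensor product of the
spaces `ℂ^(n k)`, whose standard basis is indexed by the families `x : ∀ k, Fin (n k)`. -/
def tensor {m : ℕ} {n : Fin m → ℕ} (X : ∀ k, Matrix (Fin (n k)) (Fin (n k)) ℂ) :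
    Matrix (∀ k, Fin (n k)) (∀ k, Fin (n k)) ℂ :=
  Matrix.of fun x y => ∏ k, X k (x k) (y k)

/-- The projector `|i⟩⟨i|` on the pointer state `i`. -/
def pointer {d : ℕ} (i : Fin d) : Matrix (Fin d) (Fin d) ℂ :=
  Matrix.single i i 1

/-- The partial trace over the third factor. -/
def partialTrace {α β γ : Type*} [Fintype γ] (X : Matrix (α × β × γ) (α × β × γ) ℂ) :
    Matrix (α × β) (α × β) ℂ :=
  Matrix.of fun p q => ∑ z, X (p.1, p.2, z) (q.1, q.2, z)

/-! ### The model -/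

/-- A central system of dimension `d` that interacts, in the quantum measurement limit, with an
environment of `m` observed and `l` discarded parts; `n k` and `n' k` are their dimensions. The
interaction is `A ⊗ ∑ₖ Bₖ`, where `A = ∑ᵢ aᵢ |i⟩⟨i|`, and the initial state is a product state. -/
structure Model (d m l : ℕ) (n : Fin m → ℕ) (n' : Fin l → ℕ) where
  /-- initial state of the system, in the eigenbasis of `A` -/
  ρS : Matrix (Fin d) (Fin d) ℂ
  /-- initial states of the observed parts of the environment -/
  ρE : ∀ k, Matrix (Fin (n k)) (Fin (n k)) ℂ
  /-- initial states of the discarded parts of the environment -/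
  ρD : ∀ k, Matrix (Fin (n' k)) (Fin (n' k)) ℂ
  /-- eigenvalues of `A` -/
  a : Fin d → ℝ
  /-- the observables `Bₖ` of the observed parts -/
  BE : ∀ k, Matrix (Fin (n k)) (Fin (n k)) ℂ
  /-- the observables `Bₖ` of the discarded parts -/
  BD : ∀ k, Matrix (Fin (n' k)) (Fin (n' k)) ℂ
  ρS_density : IsDensity ρS
  ρE_density : ∀ k, IsDensity (ρE k)
  ρD_density : ∀ k, IsDensity (ρD k)
  BE_hermitian : ∀ k, (BE k).IsHermitian
  BD_hermitian : ∀ k, (BD k).IsHermitian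

/-- The conditional evolution `exp(- i a t B)` of a part of the environment. -/
def localU {ι : Type*} [Fintype ι] [DecidableEq ι] (a t : ℝ) (B : Matrix ι ι ℂ) :
    Matrix ι ι ℂ :=
  NormedSpace.exp ((-(Complex.I * (a : ℂ) * (t : ℂ))) • B)

namespace Model

variable {d m l : ℕ} {n : Fin m → ℕ} {n' : Fin l → ℕ} (S : Model d m l n n')

/-- `U_i^{(k)}(t)` for an observed part. -/
def UE (t : ℝ) (i : Fin d) (k : Fin m) : Matrix (Fin (n k)) (Fin (n k)) ℂ :=
  localU (S.a i) t (S.BE k)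

/-- `U_i^{(k)}(t)` for a discarded part. -/
def UD (t : ℝ) (i : Fin d) (k : Fin l) : Matrix (Fin (n' k)) (Fin (n' k)) ℂ :=
  localU (S.a i) t (S.BD k)

/-- The initial state of the system and the whole environment. -/
def initialState : Matrix (Fin d × (∀ k, Fin (n k)) × (∀ k, Fin (n' k)))
    (Fin d × (∀ k, Fin (n k)) × (∀ k, Fin (n' k))) ℂ :=
  S.ρS ⊗ₖ (tensor S.ρE ⊗ₖ tensor S.ρD)

/-- The evolution `U(t) = ∑ᵢ |i⟩⟨i| ⊗ ⨂ₖ U_i^{(k)}(t)`. -/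
def U (t : ℝ) : Matrix (Fin d × (∀ k, Fin (n k)) × (∀ k, Fin (n' k)))
    (Fin d × (∀ k, Fin (n k)) × (∀ k, Fin (n' k))) ℂ :=
  ∑ i, pointer i ⊗ₖ (tensor (S.UE t i) ⊗ₖ tensor (S.UD t i))

/-- The actual state at time `t` of the system and the observed part of the environment: the
evolved state, traced over the discarded part. -/
def reducedState (t : ℝ) :
    Matrix (Fin d × (∀ k, Fin (n k))) (Fin d × (∀ k, Fin (n k))) ℂ :=
  partialTrace (S.U t * S.initialState * (S.U t)ᴴ)

/-- `σ_i = ⟨i|ρ_S(0)|i⟩`, a real number. -/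
def σ (i : Fin d) : ℝ := (S.ρS i i).re

/-- `ρ_{i,j}^{(k)}(t) = U_i^{(k)}(t) ρ^{(k)}(0) U_j^{(k)}(t)†` for an observed part. -/
def ρE' (t : ℝ) (i j : Fin d) (k : Fin m) : Matrix (Fin (n k)) (Fin (n k)) ℂ :=
  S.UE t i k * S.ρE k * (S.UE t j k)ᴴ

/-- `ρ_{i,j}^{(k)}(t)` for a discarded part. -/
def ρD' (t : ℝ) (i j : Fin d) (k : Fin l) : Matrix (Fin (n' k)) (Fin (n' k)) ℂ :=
  S.UD t i k * S.ρD k * (S.UD t j k)ᴴ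

/-- The conditional states `ρ_i^{(k)}(t) = ρ_{i,i}^{(k)}(t)` of the observed parts. -/
def condState (t : ℝ) (i : Fin d) (k : Fin m) : Matrix (Fin (n k)) (Fin (n k)) ℂ :=
  S.ρE' t i i k

/-- The decoherence factors `γ_{ij}^{(k)}(t)` of the discarded parts. -/
def γ (t : ℝ) (i j : Fin d) (k : Fin l) : ℂ := (S.ρD' t i j k).trace

/-- The collective decoherence factor `Γ(t)`. -/
def Γ (t : ℝ) : ℝ :=
  ∑ i, ∑ j ∈ Finset.univ.erase i, ‖S.ρS i j‖ * ∏ k, ‖S.γ t i j k‖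

/-- The bound `η`. -/
def η (t : ℝ) : ℝ :=
  S.Γ t + ∑ i, ∑ j ∈ Finset.univ.erase i,
    √(S.σ i * S.σ j) * ∑ k, fidelity (S.condState t i k) (S.condState t j k)

/-! ### Local measurements and the SBS family -/

/-- `P k i` is the projector of the observer of part `k` for the outcome `i`; for every `k` they
form a complete set of (mutually orthogonal, possibly zero) projectors. -/
structure IsMeasurement (P : ∀ k : Fin m, Fin d → Matrix (Fin (n k)) (Fin (n k)) ℂ) : Prop where
  projection : ∀ k i, IsStarProjection (P k i)
  orthogonal : ∀ k i j, i ≠ j → P k i * P k j = 0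
  complete : ∀ k, ∑ i, P k i = 1

variable (P : ∀ k : Fin m, Fin d → Matrix (Fin (n k)) (Fin (n k)) ℂ)

/-- The unnormalized projected state `P_i^{(k)} ρ_i^{(k)}(t) P_i^{(k)}`. -/
def projState (t : ℝ) (i : Fin d) (k : Fin m) : Matrix (Fin (n k)) (Fin (n k)) ℂ :=
  P k i * S.condState t i k * P k i

/-- The probability `p_i^{(k)}(t)` that the observer of part `k` finds the actual value `i`. -/
def prob (t : ℝ) (i : Fin d) (k : Fin m) : ℝ := (S.projState P t i k).trace.re

/-- The probability `r_i(t)` that all observers find the actual value `i`. -/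
def jointProb (t : ℝ) (i : Fin d) : ℝ := ∏ k, S.prob P t i k

/-- The total success probability `∑ⱼ σ_j r_j(t)`. -/
def totalProb (t : ℝ) : ℝ := ∑ j, S.σ j * S.jointProb P t j

/-- The SBS state `∑ᵢ p_i(t) |i⟩⟨i| ⊗ ⨂ₖ (P_i^{(k)} ρ_i^{(k)}(t) P_i^{(k)} / p_i^{(k)}(t))`, where
`p_i(t) = σ_i r_i(t) / ∑ⱼ σ_j r_j(t)`; a term with `p_i(t) = 0` is zero. It is meaningful when
the total success probability is positive. -/
def sbsState (t : ℝ) :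
    Matrix (Fin d × (∀ k, Fin (n k))) (Fin d × (∀ k, Fin (n k))) ℂ :=
  ∑ i, ((S.σ i * S.jointProb P t i / S.totalProb P t : ℝ) : ℂ) •
    (pointer i ⊗ₖ tensor fun k => ((S.prob P t i k : ℂ)⁻¹) • S.projState P t i k)

/-- Half the trace distance between the actual state and the SBS state for `P`. -/
def sbsDistance (t : ℝ) : ℝ :=
  1 / 2 * traceNorm (S.reducedState t - S.sbsState P t)

/-- The distances of the actual state at time `t` to the members of the SBS family, i.e. to the
SBS states of all the local measurements for which they are defined. -/
def sbsDistances (t : ℝ) : Set ℝ :=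
  {e | ∃ P : ∀ k : Fin m, Fin d → Matrix (Fin (n k)) (Fin (n k)) ℂ,
    IsMeasurement P ∧ 0 < S.totalProb P t ∧ S.sbsDistance P t = e}

end Model

end SBS

end

noncomputable section

namespace SBS

/-! ### The Hilbert–Schmidt norm -/

/-! The distance to an SBS state splits in three. Dropping the coherences between pointer states
costs at most `Γ`. Replacing each conditional state `ρ` by `PρP` costs, by telescoping over the
tensor factors, the weighted sum of the local disturbances. Normalizing costs the total failure
probability, which a union bound controls by the local ones. Hence `sbsDistance_le`: the distance is
at most `(Γ + localCost) / 2`, and it remains to find, separately for each environment, projectors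
that make the local cost small.

This is `exists_pvm_le`: for positive semidefinite `A i` there are complete orthogonal projectors
whose total disturbance plus failure is at most `2 ∑_{i≠j} ‖√(A i) √(A j)‖₁`. It is applied to `A i
= σ_i ρ_i`. Factor `√(A i) √(A j) = B_ij B_ji†` in the balanced way and put `N i = ∑ j, B_ij B_ij†`,
whose trace is the sum of the overlaps of `A i` with the others. Restrict `√(A i)` to the positive
part of `A i - N i` and let `T` be the resulting map from the direct sum of these subspaces. Its
Gram matrix is a positive definite block-diagonal matrix plus terms built from compressions of the
`B_ij`. If `Y†Y = T†T`, then `F = T Y⁻¹` is an isometry carrying the blocks to orthogonal subspaces,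
which give the projectors. The discarded parts of the `A i` pay exactly for the part of the `N i`
lost in the compression.

The choice of `Y` is essential. Among the roots of the Gram matrix take one whose block-diagonal
part `Z` has maximal Hilbert–Schmidt norm. Comparison with rotated roots shows that `Z` is
invertible and `Y = Z L` with `L` positive definite with identity diagonal blocks
(`exists_block_root`). The leakage of `Y` between blocks is then a difference of traces. The
coherences it creates solve a Lyapunov equation, whose off-diagonal blocks have trace norm bounded
by a trace (`traceNorm_lyapunov_block_le`). The two bounds add up to `∑ hsSq (β i j)` in
`exists_root_block_estimate`.

For attainment, testing against the support of an SBS state shows that the distance is at least `1 -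
totalProb`. Measurements with small success probability therefore cannot compete with a distance
below `1`, and the others form a compact set on which the distance is continuous. If no distance is
below `1`, all of them equal `1`. -/

/-- The squared Hilbert–Schmidt norm. -/
def hsSq {α β : Type*} [Fintype α] [Fintype β] (B : Matrix α β ℂ) : ℝ := (B * Bᴴ).trace.re

section HilbertSchmidt

variable {α β γ : Type*} [Fintype α] [Fintype β] [Fintype γ]

lemma hsSq_eq_sum (B : Matrix α β ℂ) : hsSq B = ∑ i, ∑ j, ‖B i j‖ ^ 2 := by
  simp [hsSq, Matrix.trace, Matrix.mul_apply, Complex.mul_conj, Complex.normSq_eq_norm_sq, ← Complex.ofReal_pow]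

lemma hsSq_nonneg (B : Matrix α β ℂ) : 0 ≤ hsSq B := by
  rw [hsSq_eq_sum]; positivity

lemma hsSq_conjTranspose (B : Matrix α β ℂ) : hsSq Bᴴ = hsSq B := by
  rw [hsSq, hsSq, conjTranspose_conjTranspose, trace_mul_comm]

lemma hsSq_eq_zero {B : Matrix α β ℂ} (h : hsSq B = 0) : B = 0 := by
  rw [hsSq_eq_sum, Finset.sum_eq_zero_iff_of_nonneg (fun _ _ => by positivity)] at h
  ext i j
  have h1 := h i (Finset.mem_univ _)
  rw [Finset.sum_eq_zero_iff_of_nonneg (fun _ _ => by positivity)] at h1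
  simpa using h1 j (Finset.mem_univ _)

lemma re_trace_conjTranspose (A : Matrix α α ℂ) : (Aᴴ).trace.re = A.trace.re := by
  simp [trace_conjTranspose]

lemma hsSq_sub (B C : Matrix α β ℂ) :
    hsSq (B - C) = hsSq B + hsSq C - 2 * (B * Cᴴ).trace.re := by
  have h : (C * Bᴴ).trace.re = (B * Cᴴ).trace.re := by
    rw [← re_trace_conjTranspose]; simp
  simp only [hsSq, conjTranspose_sub, Matrix.sub_mul, Matrix.mul_sub, trace_sub, Complex.sub_re, h]
  ring

lemma two_re_trace_le (B C : Matrix α β ℂ) : 2 * (B * Cᴴ).trace.re ≤ hsSq B + hsSq C := by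
  have := hsSq_nonneg (B - C)
  rw [hsSq_sub] at this
  linarith

lemma PosSemidef_trace_re_nonneg {A : Matrix α α ℂ} (hA : A.PosSemidef) : 0 ≤ A.trace.re :=
  (Complex.nonneg_iff.1 hA.trace_nonneg).1

/-- The trace of a product of positive semidefinite matrices is nonnegative. -/
lemma re_trace_mul_nonneg {A B : Matrix α α ℂ} (hA : A.PosSemidef) (hB : B.PosSemidef) :
    0 ≤ (A * B).trace.re := by
  classical
  obtain ⟨C, rfl⟩ := CStarAlgebra.nonneg_iff_eq_star_mul_self.mp hB.nonneg
  rw [star_eq_conjTranspose, ← mul_assoc, trace_mul_comm, ← mul_assoc]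
  exact PosSemidef_trace_re_nonneg (hA.mul_mul_conjTranspose_same C)

/-- A contraction between finite-dimensional spaces. -/
def IsContraction [DecidableEq β] (W : Matrix α β ℂ) : Prop := (1 - Wᴴ * W).PosSemidef

lemma hsSq_mul_le [DecidableEq β] {W : Matrix α β ℂ} (hW : IsContraction W) (C : Matrix β γ ℂ) :
    hsSq (W * C) ≤ hsSq C := by
  have h := re_trace_mul_nonneg hW (posSemidef_self_mul_conjTranspose C)
  have e : ((W * C) * (W * C)ᴴ).trace = (Wᴴ * W * (C * Cᴴ)).trace := by
    rw [conjTranspose_mul, trace_mul_comm]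
    rw [trace_mul_comm (Wᴴ * W)]
    simp only [Matrix.mul_assoc]
    rw [trace_mul_comm C]
    simp only [Matrix.mul_assoc]
  rw [sub_mul, one_mul, trace_sub, Complex.sub_re] at h
  simp only [hsSq, e]
  linarith

lemma hsSq_smul (c : ℂ) (B : Matrix α β ℂ) : hsSq (c • B) = ‖c‖ ^ 2 * hsSq B := by
  simp only [hsSq_eq_sum, Matrix.smul_apply, smul_eq_mul, norm_mul, mul_pow, Finset.mul_sum]

lemma isContraction_of_isometry [DecidableEq β] {W : Matrix α β ℂ} (h : Wᴴ * W = 1) :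
    IsContraction W := by
  simp [IsContraction, h, PosSemidef.zero]

lemma isContraction_of_proj [DecidableEq α] {P : Matrix α α ℂ} (h : IsStarProjection P) :
    IsContraction P := by
  have h1 : Pᴴ = P := h.isSelfAdjoint
  have h2 : P * P = P := h.isIdempotentElem
  have h3 : (1 - P)ᴴ * (1 - P) = 1 - P := by
    simp [h1, sub_mul, mul_sub, h2]
  rw [IsContraction, h1, h2, ← h3]
  exact posSemidef_conjTranspose_mul_self _

end HilbertSchmidt

/-! ### The trace norm -/

section TraceNorm

variable {α β γ : Type*} [Fintype α] [Fintype β] [Fintype γ] [DecidableEq α] [DecidableEq β]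

/-- The spectral theorem, with a plain unitary matrix. -/
lemma exists_diagonalization {A : Matrix α α ℂ} (hA : A.IsHermitian) :
    ∃ (U : Matrix α α ℂ) (v : α → ℝ), Uᴴ * U = 1 ∧ U * Uᴴ = 1 ∧
      A = U * diagonal (fun i => (v i : ℂ)) * Uᴴ := by
  refine ⟨hA.eigenvectorUnitary, hA.eigenvalues, ?_, ?_, ?_⟩
  · exact Unitary.coe_star_mul_self hA.eigenvectorUnitary
  · exact Unitary.coe_mul_star_self hA.eigenvectorUnitary
  · have := hA.spectral_theorem
    rw [Unitary.conjStarAlgAut_apply] at this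
    exact this

lemma diag_mul_mul_eq_of_unitary {U D A : Matrix α α ℂ} (hU : Uᴴ * U = 1)
    (h : A = U * D * Uᴴ) : Uᴴ * A * U = D := by
  rw [h]
  calc Uᴴ * (U * D * Uᴴ) * U = (Uᴴ * U) * D * (Uᴴ * U) := by simp only [mul_assoc]
    _ = D := by rw [hU]; simp

/-- A diagonalization of `X† X` computes the trace norm of `X`. -/
lemma exists_singular_values (X : Matrix α α ℂ) :
    ∃ (U : Matrix α α ℂ) (v : α → ℝ), (∀ i, 0 ≤ v i) ∧ Uᴴ * U = 1 ∧ U * Uᴴ = 1 ∧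
      (X * U)ᴴ * (X * U) = diagonal (fun i => ((v i : ℝ) : ℂ)) ∧ traceNorm X = ∑ i, √(v i) := by
  have hA := posSemidef_conjTranspose_mul_self X
  obtain ⟨U, v, h1, h2, h3⟩ := exists_diagonalization hA.isHermitian
  have h4 := diag_mul_mul_eq_of_unitary h1 h3
  have hv : ∀ i, 0 ≤ v i := by
    intro i
    have h5 := (hA.conjTranspose_mul_mul_same U).diag_nonneg (i := i)
    rw [h4, diagonal_apply_eq] at h5
    exact_mod_cast h5
  refine ⟨U, v, hv, h1, h2, ?_, ?_⟩
  · rw [← h4]; simp [mul_assoc]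
  · have h6 : CFC.sqrt (Xᴴ * X) = U * diagonal (fun i => ((√(v i) : ℝ) : ℂ)) * Uᴴ := by
      refine CFC.sqrt_unique ?_ ?_
      · rw [h3]
        calc _ = U * diagonal (fun i => ((√(v i) : ℝ) : ℂ)) * (Uᴴ * U) *
              diagonal (fun i => ((√(v i) : ℝ) : ℂ)) * Uᴴ := by simp only [mul_assoc]
          _ = _ := by
            rw [h1, mul_one, mul_assoc U, diagonal_mul_diagonal]
            simp [← Complex.ofReal_mul, Real.mul_self_sqrt (hv _)]
      · refine Matrix.PosSemidef.nonneg ?_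
        refine PosSemidef.mul_mul_conjTranspose_same (PosSemidef.diagonal ?_) U
        intro i
        simp
    rw [traceNorm, h6, trace_mul_cycle, h1, one_mul, trace_diagonal]
    simp

lemma traceNorm_nonneg (X : Matrix α α ℂ) : 0 ≤ traceNorm X := by
  obtain ⟨U, v, -, -, -, -, h⟩ := exists_singular_values X
  rw [h]; positivity

/-- Every matrix has a factorization into two Hilbert–Schmidt factors that is balanced and
optimal for the trace norm. -/
lemma exists_factorization (X : Matrix α α ℂ) :
    ∃ B C : Matrix α α ℂ, X = B * Cᴴ ∧ hsSq B = traceNorm X ∧ hsSq C = traceNorm X := by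
  obtain ⟨U, v, hv, h1, h2, h3, h4⟩ := exists_singular_values X
  -- The `v i` are squared singular values; splitting each singular value evenly between the factors
  -- makes both squared Hilbert–Schmidt norms equal to the trace norm.
  set q : α → ℝ := fun i => √(√(v i)) with hq
  have hq2 : ∀ i, q i * q i = √(v i) := fun i => Real.mul_self_sqrt (Real.sqrt_nonneg _)
  have hq4 : ∀ i, v i = (q i) ^ 4 := fun i => by
    have : q i ^ 4 = (q i * q i) * (q i * q i) := by ring
    rw [this, hq2, Real.mul_self_sqrt (hv i)]
  -- A zero singular value has a vanishing column, so the convention `0⁻¹ = 0` loses nothing.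
  have hz : ∀ i, q i = 0 → ∀ a, (X * U) a i = 0 := by
    intro i hi a
    have h5 : ((X * U)ᴴ * (X * U)) i i = 0 := by rw [h3]; simp [hq4 i, hi]
    have h6 : ∑ a, ‖(X * U) a i‖ ^ 2 = 0 := by
      have : (((X * U)ᴴ * (X * U)) i i) = ((∑ a, ‖(X * U) a i‖ ^ 2 : ℝ) : ℂ) := by
        rw [mul_apply]
        simp [Complex.conj_mul']
      rw [h5] at this
      exact_mod_cast this.symm
    rw [Finset.sum_eq_zero_iff_of_nonneg (fun _ _ => by positivity)] at h6
    simpa using h6 a (Finset.mem_univ _)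
  refine ⟨X * U * diagonal (fun i => (((q i)⁻¹ : ℝ) : ℂ)),
    U * diagonal (fun i => ((q i : ℝ) : ℂ)), ?_, ?_, ?_⟩
  · have h5 : X * U * diagonal (fun i => (((q i)⁻¹ : ℝ) : ℂ)) * diagonal (fun i => ((q i : ℝ) : ℂ))
        = X * U := by
      ext a i
      rw [mul_diagonal, mul_diagonal]
      by_cases hi : q i = 0
      · simp [hz i hi a]
      · rw [mul_assoc, ← Complex.ofReal_mul, inv_mul_cancel₀ hi]; simp
    have h6 : (diagonal fun i => ((q i : ℝ) : ℂ))ᴴ = diagonal fun i => ((q i : ℝ) : ℂ) := by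
      rw [diagonal_conjTranspose]; congr 1; ext i; simp
    rw [conjTranspose_mul, h6, ← mul_assoc, h5, mul_assoc, h2, mul_one]
  · rw [← hsSq_conjTranspose, hsSq, conjTranspose_conjTranspose, conjTranspose_mul, mul_assoc,
      ← mul_assoc (X * U)ᴴ, h3, h4, diagonal_conjTranspose, diagonal_mul_diagonal,
      diagonal_mul_diagonal, trace_diagonal, Complex.re_sum]
    refine Finset.sum_congr rfl fun i _ => ?_
    have : (q i)⁻¹ * (v i * (q i)⁻¹) = √(v i) := by
      rw [← hq2, hq4 i]
      by_cases hi : q i = 0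
      · simp [hi]
      · field_simp
    rw [← this]
    simp
  · rw [← hsSq_conjTranspose, hsSq, conjTranspose_conjTranspose, conjTranspose_mul, mul_assoc,
      ← mul_assoc Uᴴ, h1, one_mul, h4, diagonal_conjTranspose, diagonal_mul_diagonal,
      trace_diagonal, Complex.re_sum]
    refine Finset.sum_congr rfl fun i _ => ?_
    rw [← hq2]
    simp

/-- The trace norm is attained at a contraction. -/
lemma exists_contraction_trace (X : Matrix α α ℂ) :
    ∃ W : Matrix α α ℂ, IsContraction W ∧ (X * Wᴴ).trace.re = traceNorm X := by
  obtain ⟨U, v, hv, h1, h2, h3, h4⟩ := exists_singular_values X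
  set D : Matrix α α ℂ := diagonal (fun i => (((√(v i))⁻¹ : ℝ) : ℂ)) with hD
  have hDs : Dᴴ = D := by
    rw [hD, diagonal_conjTranspose]; congr 1; ext i; simp
  -- The partial isometry of the polar decomposition: `D` inverts the nonzero singular values and
  -- kills the others, which is why `W` is only a contraction.
  refine ⟨X * U * D * Uᴴ, ?_, ?_⟩
  · have h5 : (X * U * D * Uᴴ)ᴴ * (X * U * D * Uᴴ)
        = U * (D * ((X * U)ᴴ * (X * U)) * D) * Uᴴ := by
      rw [conjTranspose_mul, conjTranspose_mul (X * U), hDs, conjTranspose_conjTranspose]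
      simp only [mul_assoc]
    have h6 : (1 : Matrix α α ℂ) = U * 1 * Uᴴ := by simp [h2]
    rw [IsContraction, h5, h6, ← sub_mul, ← mul_sub, h3, hD, diagonal_mul_diagonal,
      diagonal_mul_diagonal, ← diagonal_one, diagonal_sub]
    refine PosSemidef.mul_mul_conjTranspose_same (PosSemidef.diagonal ?_) U
    intro i
    have : (√(v i))⁻¹ * v i * (√(v i))⁻¹ ≤ 1 := by
      rcases eq_or_ne (√(v i)) 0 with h | h
      · simp [h]
      · have : v i = √(v i) * √(v i) := (Real.mul_self_sqrt (hv i)).symm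
        conv_lhs => rw [this]
        field_simp
        simp
    have h7 : (0 : ℂ) ≤ ((1 - (√(v i))⁻¹ * v i * (√(v i))⁻¹ : ℝ) : ℂ) := by
      exact_mod_cast sub_nonneg.2 this
    simpa using h7
  · have h5 : (X * (X * U * D * Uᴴ)ᴴ).trace = (D * ((X * U)ᴴ * (X * U))).trace := by
      rw [conjTranspose_mul, conjTranspose_mul (X * U), hDs, conjTranspose_conjTranspose,
        ← mul_assoc, ← mul_assoc, trace_mul_comm, trace_mul_comm D]
      simp only [mul_assoc]
    rw [h5, h3, h4, hD, diagonal_mul_diagonal, trace_diagonal, Complex.re_sum]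
    refine Finset.sum_congr rfl fun i _ => ?_
    rw [← Complex.ofReal_mul, Complex.ofReal_re]
    rcases eq_or_ne (√(v i)) 0 with h | h
    · simp [h]
    · rw [inv_mul_eq_iff_eq_mul₀ h, Real.mul_self_sqrt (hv i)]

/-- A factorization into Hilbert–Schmidt factors bounds the trace norm. -/
lemma traceNorm_mul_conjTranspose_le (B C : Matrix α γ ℂ) :
    traceNorm (B * Cᴴ) ≤ (hsSq B + hsSq C) / 2 := by
  obtain ⟨W, hW, h⟩ := exists_contraction_trace (B * Cᴴ)
  have h1 : (B * Cᴴ * Wᴴ) = B * (W * C)ᴴ := by rw [conjTranspose_mul, Matrix.mul_assoc]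
  rw [← h, h1]
  have := two_re_trace_le B (W * C)
  have := hsSq_mul_le hW C
  linarith

lemma traceNorm_conjTranspose_le (X : Matrix α α ℂ) : traceNorm Xᴴ ≤ traceNorm X := by
  obtain ⟨B, C, h, hB, hC⟩ := exists_factorization X
  have : Xᴴ = C * Bᴴ := by rw [h]; simp
  rw [this]
  refine (traceNorm_mul_conjTranspose_le C B).trans ?_
  linarith

lemma traceNorm_conjTranspose (X : Matrix α α ℂ) : traceNorm Xᴴ = traceNorm X :=
  le_antisymm (traceNorm_conjTranspose_le X) (by simpa using traceNorm_conjTranspose_le Xᴴ)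

lemma traceNorm_of_posSemidef {X : Matrix α α ℂ} (h : X.PosSemidef) :
    traceNorm X = X.trace.re := by
  rw [traceNorm, h.isHermitian.eq, CFC.sqrt_mul_self X h.nonneg]

/-- The trace against a contraction is bounded by the trace norm. -/
lemma re_trace_mul_le_traceNorm (X : Matrix α α ℂ) {W : Matrix α α ℂ} (hW : IsContraction W) :
    (X * Wᴴ).trace.re ≤ traceNorm X := by
  obtain ⟨B, C, e, hB, hC⟩ := exists_factorization X
  have h1 : (X * Wᴴ) = B * (W * C)ᴴ := by rw [e, conjTranspose_mul, mul_assoc]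
  rw [h1]
  have := two_re_trace_le B (W * C)
  have := hsSq_mul_le hW C
  linarith

/-- Duality: the contraction that attains the norm of the sum is a competitor for each summand. -/
lemma traceNorm_add_le (X Y : Matrix α α ℂ) : traceNorm (X + Y) ≤ traceNorm X + traceNorm Y := by
  obtain ⟨W, hW, h⟩ := exists_contraction_trace (X + Y)
  rw [← h, add_mul, trace_add, Complex.add_re]
  exact add_le_add (re_trace_mul_le_traceNorm X hW) (re_trace_mul_le_traceNorm Y hW)

@[simp] lemma traceNorm_zero : traceNorm (0 : Matrix α α ℂ) = 0 := by
  rw [traceNorm_of_posSemidef PosSemidef.zero]; simp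

lemma traceNorm_neg (X : Matrix α α ℂ) : traceNorm (-X) = traceNorm X := by
  simp [traceNorm]

lemma traceNorm_sub_le (X Y : Matrix α α ℂ) : traceNorm (X - Y) ≤ traceNorm X + traceNorm Y := by
  rw [sub_eq_add_neg, ← traceNorm_neg Y]
  exact traceNorm_add_le _ _

lemma traceNorm_sum_le {κ : Type*} (s : Finset κ) (X : κ → Matrix α α ℂ) :
    traceNorm (∑ k ∈ s, X k) ≤ ∑ k ∈ s, traceNorm (X k) := by
  classical
  induction s using Finset.induction_on with
  | empty => simp
  | insert a s ha ih =>
    rw [Finset.sum_insert ha, Finset.sum_insert ha]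
    exact (traceNorm_add_le _ _).trans (add_le_add le_rfl ih)

/-- The trace norm does not increase under contractions. -/
lemma traceNorm_mul_mul_le {E F : Matrix β α ℂ} (hE : IsContraction E) (hF : IsContraction F)
    (X : Matrix α α ℂ) : traceNorm (E * X * Fᴴ) ≤ traceNorm X := by
  obtain ⟨B, C, h, hB, hC⟩ := exists_factorization X
  have : E * X * Fᴴ = (E * B) * (F * C)ᴴ := by rw [h, conjTranspose_mul]; simp only [Matrix.mul_assoc]
  rw [this]
  refine (traceNorm_mul_conjTranspose_le _ _).trans ?_
  have := hsSq_mul_le hE B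
  have := hsSq_mul_le hF C
  linarith

lemma traceNorm_smul_le (c : ℂ) (X : Matrix α α ℂ) :
    traceNorm (c • X) ≤ ‖c‖ * traceNorm X := by
  obtain ⟨B, C, h, hB, hC⟩ := exists_factorization X
  rcases eq_or_ne c 0 with rfl | hc
  · simp
  have hn : 0 < ‖c‖ := norm_pos_iff.2 hc
  set s : ℝ := √‖c‖ with hs
  have hs2 : s ^ 2 = ‖c‖ := Real.sq_sqrt hn.le
  have hs0 : 0 < s := Real.sqrt_pos.2 hn
  have e : c • X = ((c / s) • B) * ((s : ℂ) • C)ᴴ := by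
    have : (s : ℂ) ≠ 0 := by exact_mod_cast hs0.ne'
    rw [h, conjTranspose_smul, smul_mul_smul_comm]
    congr 1
    rw [Complex.star_def, Complex.conj_ofReal]
    field_simp
  rw [e]
  refine (traceNorm_mul_conjTranspose_le _ _).trans ?_
  rw [hsSq_smul, hsSq_smul, hB, hC, norm_div, Complex.norm_real, Real.norm_of_nonneg hs0.le,
    div_pow, hs2]
  have : ‖c‖ ^ 2 / ‖c‖ = ‖c‖ := by field_simp
  rw [this]
  linarith

/-- The off-diagonal part of a positive semidefinite matrix. -/
lemma traceNorm_offDiag_le {S E : Matrix α α ℂ} (hS : S.PosSemidef) (hE : IsStarProjection E) :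
    traceNorm (E * S * (1 - E)) ≤ S.trace.re / 2 := by
  obtain ⟨C, rfl⟩ := CStarAlgebra.nonneg_iff_eq_star_mul_self.mp hS.nonneg
  have h1 : Eᴴ = E := hE.isSelfAdjoint
  have h2 : E * E = E := hE.isIdempotentElem
  -- The squared Hilbert–Schmidt norms of these two factors add up to the trace of `S`, and the
  -- factorization bound takes half of it.
  have e : E * (star C * C) * (1 - E) = (E * Cᴴ) * ((1 - E) * Cᴴ)ᴴ := by
    simp [conjTranspose_mul, star_eq_conjTranspose, h1, mul_assoc]
  rw [e]
  refine (traceNorm_mul_conjTranspose_le _ _).trans ?_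
  have h3 : hsSq (E * Cᴴ) = (E * (Cᴴ * C)).trace.re := by
    rw [hsSq, conjTranspose_mul, conjTranspose_conjTranspose, h1, trace_mul_comm]
    rw [show C * E * (E * Cᴴ) = C * (E * E) * Cᴴ by simp only [mul_assoc], h2, trace_mul_cycle,
      trace_mul_comm]
  have h4 : hsSq ((1 - E) * Cᴴ) = ((1 - E) * (Cᴴ * C)).trace.re := by
    have h5 : (1 - E) * (1 - E) = 1 - E := by simp [sub_mul, mul_sub, h2]
    rw [hsSq, conjTranspose_mul, conjTranspose_conjTranspose, conjTranspose_sub,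
      conjTranspose_one, h1, trace_mul_comm]
    rw [show C * (1 - E) * ((1 - E) * Cᴴ) = C * ((1 - E) * (1 - E)) * Cᴴ by
      simp only [mul_assoc], h5, trace_mul_cycle, trace_mul_comm]
  rw [h3, h4, sub_mul, trace_sub, Complex.sub_re, one_mul, star_eq_conjTranspose]
  linarith

end TraceNorm

/-! ### Projective measurements and pinching -/

section Pinching

variable {κ ι : Type*} [Fintype κ] [Fintype ι] [DecidableEq ι]

/-- A complete family of mutually orthogonal projectors. -/
structure IsPVM (E : κ → Matrix ι ι ℂ) : Prop where
  projection : ∀ i, IsStarProjection (E i)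
  orthogonal : ∀ i j, i ≠ j → E i * E j = 0
  complete : ∑ i, E i = 1

/-- The block-diagonal part of a matrix. -/
def pinch (E : κ → Matrix ι ι ℂ) (Y : Matrix ι ι ℂ) : Matrix ι ι ℂ := ∑ i, E i * Y * E i

variable {E : κ → Matrix ι ι ℂ}

lemma IsPVM.conjTranspose (h : IsPVM E) (i : κ) : (E i)ᴴ = E i := (h.projection i).isSelfAdjoint

lemma IsPVM.mul_self (h : IsPVM E) (i : κ) : E i * E i = E i :=
  (h.projection i).isIdempotentElem

lemma IsPVM.mul_pinch (h : IsPVM E) (i : κ) (Y : Matrix ι ι ℂ) :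
    E i * pinch E Y = E i * Y * E i := by
  rw [pinch, Finset.mul_sum, Finset.sum_eq_single i]
  · rw [← mul_assoc, ← mul_assoc, h.mul_self]
  · intro j _ hj
    rw [← mul_assoc, ← mul_assoc, h.orthogonal i j hj.symm]; simp
  · simp

lemma IsPVM.pinch_mul (h : IsPVM E) (i : κ) (Y : Matrix ι ι ℂ) :
    pinch E Y * E i = E i * Y * E i := by
  rw [pinch, Finset.sum_mul, Finset.sum_eq_single i]
  · rw [mul_assoc, h.mul_self]
  · intro j _ hj
    rw [mul_assoc, h.orthogonal j i hj]; simp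
  · simp

lemma IsPVM.pinch_conjTranspose (h : IsPVM E) (Y : Matrix ι ι ℂ) :
    (pinch E Y)ᴴ = pinch E Yᴴ := by
  simp [pinch, conjTranspose_sum, h.conjTranspose, mul_assoc]

lemma IsPVM.pinch_of_commute (h : IsPVM E) {B : Matrix ι ι ℂ} (hB : ∀ i, E i * B = B * E i) :
    pinch E B = B := by
  simp only [pinch, hB, mul_assoc, h.mul_self]
  rw [← Finset.mul_sum, h.complete, mul_one]

lemma IsPVM.pinch_pinch (h : IsPVM E) (Y : Matrix ι ι ℂ) : pinch E (pinch E Y) = pinch E Y :=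
  h.pinch_of_commute fun i => by rw [h.mul_pinch, h.pinch_mul]

lemma pinch_mul_of_commute {B : Matrix ι ι ℂ} (hB : ∀ i, E i * B = B * E i) (Y : Matrix ι ι ℂ) :
    pinch E (B * Y) = B * pinch E Y := by
  simp only [pinch, Finset.mul_sum, ← mul_assoc, hB]

/-- Pinching is symmetric for the trace pairing; with idempotence it becomes an orthogonal
projection for the Hilbert–Schmidt product. -/
lemma trace_pinch_mul (X Y : Matrix ι ι ℂ) :
    (pinch E X * Y).trace = (X * pinch E Y).trace := by
  simp only [pinch, Finset.sum_mul, Finset.mul_sum, trace_sum]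
  refine Finset.sum_congr rfl fun i _ => ?_
  rw [mul_assoc, mul_assoc, trace_mul_comm]
  simp only [mul_assoc]

lemma IsPVM.trace_pinch_mul_conjTranspose (h : IsPVM E) (X Y : Matrix ι ι ℂ) :
    (pinch E X * (pinch E Y)ᴴ).trace = (X * (pinch E Y)ᴴ).trace := by
  rw [trace_pinch_mul, h.pinch_conjTranspose, h.pinch_pinch]

lemma pinch_add (X Y : Matrix ι ι ℂ) : pinch E (X + Y) = pinch E X + pinch E Y := by
  simp [pinch, mul_add, add_mul, Finset.sum_add_distrib]

lemma pinch_smul (c : ℂ) (X : Matrix ι ι ℂ) : pinch E (c • X) = c • pinch E X := by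
  simp [pinch, Finset.smul_sum]

lemma IsPVM.trace_pinch (h : IsPVM E) (X : Matrix ι ι ℂ) : (pinch E X).trace = X.trace := by
  have := trace_pinch_mul (E := E) X 1
  rw [mul_one, h.pinch_of_commute (B := 1) (by simp), mul_one] at this
  exact this

lemma IsPVM.sum_mulVec (h : IsPVM E) (v : ι → ℂ) : ∑ i, E i *ᵥ v = v := by
  rw [← Matrix.sum_mulVec, h.complete, one_mulVec]

end Pinching

/-! ### Compactness -/

section Compact

/-- A closed set of matrices with bounded entries is compact. -/
lemma isCompact_of_norm_le {α β : Type*} {s : Set (Matrix α β ℂ)} (hs : IsClosed s) (C : ℝ)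
    (hC : ∀ W ∈ s, ∀ i j, ‖W i j‖ ≤ C) : IsCompact s := by
  have h : IsCompact (Set.pi Set.univ fun _ : α => Set.pi Set.univ fun _ : β =>
      Metric.closedBall (0 : ℂ) C) :=
    isCompact_univ_pi fun _ => isCompact_univ_pi fun _ => isCompact_closedBall _ _
  refine IsCompact.of_isClosed_subset h hs fun W hW => ?_
  intro i _ j _
  simpa using hC W hW i j

lemma norm_entry_sq_le_hsSq {α β : Type*} [Fintype α] [Fintype β] (B : Matrix α β ℂ) (i : α)
    (j : β) : ‖B i j‖ ^ 2 ≤ hsSq B := by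
  rw [hsSq_eq_sum]
  refine le_trans ?_ (Finset.single_le_sum (f := fun i => ∑ j, ‖B i j‖ ^ 2)
    (fun _ _ => by positivity) (Finset.mem_univ i))
  exact Finset.single_le_sum (f := fun j => ‖B i j‖ ^ 2) (fun _ _ => by positivity)
    (Finset.mem_univ j)

lemma isCompact_unitary {ι : Type*} [Fintype ι] [DecidableEq ι] :
    IsCompact {W : Matrix ι ι ℂ | Wᴴ * W = 1} := by
  refine isCompact_of_norm_le (isClosed_eq (by fun_prop) continuous_const)
    (√(Fintype.card ι)) fun W hW i j => ?_
  refine Real.le_sqrt_of_sq_le ((norm_entry_sq_le_hsSq W i j).trans ?_)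
  rw [← hsSq_conjTranspose, hsSq, conjTranspose_conjTranspose, hW]
  simp

lemma continuous_hsSq {α β : Type*} [Fintype α] [Fintype β] :
    Continuous (hsSq : Matrix α β ℂ → ℝ) := by
  have : (hsSq : Matrix α β ℂ → ℝ) = fun B => ∑ i, ∑ j, ‖B i j‖ ^ 2 := by
    ext B; exact hsSq_eq_sum B
  rw [this]
  fun_prop

lemma continuous_pinch {κ ι : Type*} [Fintype κ] [Fintype ι] [DecidableEq ι]
    (E : κ → Matrix ι ι ℂ) : Continuous (pinch E) := by
  unfold pinch
  fun_prop

end Compact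

/-! ### A block-normalized square root -/

section BlockRoot

variable {κ ι : Type*} [Fintype κ] [Fintype ι] [DecidableEq ι] {E : κ → Matrix ι ι ℂ}

lemma hsSq_add_smul {α β : Type*} [Fintype α] [Fintype β] (A B : Matrix α β ℂ) (c : ℂ) :
    hsSq (A + c • B) = hsSq A + 2 * (c * (B * Aᴴ).trace).re + ‖c‖ ^ 2 * hsSq B := by
  have h := hsSq_sub A (-(c • B))
  have h1 : hsSq (-(c • B)) = ‖c‖ ^ 2 * hsSq B := by
    simp only [hsSq_eq_sum, Matrix.neg_apply, norm_neg, Matrix.smul_apply, smul_eq_mul, norm_mul,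
      mul_pow, Finset.mul_sum]
  have h2 : (A * (-(c • B))ᴴ).trace.re = -(c * (B * Aᴴ).trace).re := by
    rw [← re_trace_conjTranspose]
    simp
  rw [sub_neg_eq_add, h1, h2] at h
  rw [h]; ring

/-- The first and second order conditions at a maximum of `‖pinch (W S)‖` over unitaries `W`. -/
lemma IsPVM.variation (h : IsPVM E) {Y : Matrix ι ι ℂ}
    (hmax : ∀ W : Matrix ι ι ℂ, Wᴴ * W = 1 → hsSq (pinch E (W * Y)) ≤ hsSq (pinch E Y))
    {p : Matrix ι ι ℂ} (hp : IsStarProjection p) :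
    0 ≤ (p * (Y * (pinch E Y)ᴴ)).trace ∧
      hsSq (pinch E (p * Y)) ≤ (p * (Y * (pinch E Y)ᴴ)).trace.re := by
  have hp1 : pᴴ = p := hp.isSelfAdjoint
  have hp2 : p * p = p := hp.isIdempotentElem
  set c := (p * (Y * (pinch E Y)ᴴ)).trace with hc
  -- Compare with the unitary `1 + (z - 1) p`, which multiplies the range of `p` by the phase `z`;
  -- the squared norm is quadratic in `z - 1`.
  have key : ∀ z : ℂ, ‖z‖ = 1 →
      2 * ((z - 1) * c).re + ‖z - 1‖ ^ 2 * hsSq (pinch E (p * Y)) ≤ 0 := by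
    intro z hz
    have hz' : star z * z = 1 := by
      rw [Complex.star_def, Complex.conj_mul', hz]; simp
    have hW : (1 + (z - 1) • p)ᴴ * (1 + (z - 1) • p) = 1 := by
      have : (1 + (z - 1) • p)ᴴ * (1 + (z - 1) • p) = 1 + (star z * z - 1) • p := by
        simp only [conjTranspose_add, conjTranspose_one, conjTranspose_smul, hp1, mul_add, add_mul,
          one_mul, mul_one, smul_mul_smul_comm, hp2, star_sub, star_one, add_assoc, ← add_smul]
        congr 2; ring
      rw [this, hz']; simp
    have h1 := hmax _ hW
    rw [add_mul, one_mul, smul_mul_assoc, pinch_add, pinch_smul, hsSq_add_smul,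
      h.trace_pinch_mul_conjTranspose, mul_assoc, ← hc] at h1
    linarith
  have h0 := hsSq_nonneg (pinch E (p * Y))
  constructor
  · by_cases hc0 : c = 0
    · rw [hc0]
    have hn : (‖c‖ : ℂ) ≠ 0 := by simpa using hc0
    -- The phase that turns `c` into `‖c‖` forces `‖c‖ ≤ Re c`.
    have h1 := key (star c / ‖c‖) (by
      rw [norm_div, norm_star]; simp [hc0])
    have h2 : (star c / ‖c‖ - 1) * c = ((‖c‖ : ℝ) : ℂ) - c := by
      rw [sub_mul, one_mul, div_mul_eq_mul_div, Complex.star_def, Complex.conj_mul']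
      congr 1
      field_simp
    rw [h2, Complex.sub_re, Complex.ofReal_re] at h1
    have h3 : ‖c‖ ≤ c.re := by
      have : 0 ≤ ‖star c / (‖c‖ : ℂ) - 1‖ ^ 2 * hsSq (pinch E (p * Y)) := by positivity
      linarith
    exact Complex.re_eq_norm.1 (le_antisymm (Complex.re_le_norm c) h3)
  -- The reflection `1 - 2p` makes the quadratic term comparable with the linear one.
  · have h1 := key (-1) (by simp)
    have h2 : ‖(-1 : ℂ) - 1‖ ^ 2 = 4 := by norm_num
    have h3 : ((-1 - 1) * c).re = -2 * c.re := by
      rw [show ((-1 : ℂ) - 1) = ((-2 : ℝ) : ℂ) by norm_num, Complex.re_ofReal_mul]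
    rw [h2, h3] at h1
    linarith

/-- The projector on the line spanned by a vector. -/
lemma isStarProjection_vecMulVec {v : ι → ℂ} (hv : v ≠ 0) :
    IsStarProjection ((star v ⬝ᵥ v)⁻¹ • vecMulVec v (star v)) := by
  have h0 : star v ⬝ᵥ v ≠ 0 := by
    rwa [Ne, dotProduct_star_self_eq_zero]
  have hs : star (star v ⬝ᵥ v) = star v ⬝ᵥ v := by
    rw [← star_dotProduct_star, star_star, dotProduct_comm]
  constructor
  · rw [IsIdempotentElem, smul_mul_smul_comm, vecMulVec_mul_vecMulVec, vecMulVec_smul, smul_smul,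
      mul_assoc, inv_mul_cancel₀ h0, mul_one]
  · rw [IsSelfAdjoint, star_eq_conjTranspose, conjTranspose_smul, conjTranspose_vecMulVec,
      star_star, star_inv₀, hs]

/-- Nonnegativity in `ℂ` includes being real, so the quadratic form already forces the matrix to be
Hermitian. -/
lemma posSemidef_of_forall_nonneg {K : Matrix ι ι ℂ} (h : ∀ v, 0 ≤ star v ⬝ᵥ K *ᵥ v) :
    K.PosSemidef := by
  refine PosSemidef.of_dotProduct_mulVec_nonneg ?_ h
  rw [← isSymmetric_toEuclideanLin_iff, LinearMap.isSymmetric_iff_inner_map_self_real]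
  intro v
  have h1 := (Complex.nonneg_iff.1 (h v.ofLp)).2
  have h2 : inner ℂ (toEuclideanLin K v) v = star (star v.ofLp ⬝ᵥ K *ᵥ v.ofLp) := by
    rw [EuclideanSpace.inner_eq_star_dotProduct, star_dotProduct, dotProduct_comm]
    simp [toLpLin_apply]
  rw [h2]
  have h3 : (star v.ofLp ⬝ᵥ K *ᵥ v.ofLp) = (((star v.ofLp ⬝ᵥ K *ᵥ v.ofLp).re : ℝ) : ℂ) := by
    apply Complex.ext <;> simp [← h1]
  rw [h3]
  simp

lemma trace_vecMulVec_mul (v : ι → ℂ) (K : Matrix ι ι ℂ) :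
    (vecMulVec v (star v) * K).trace = star v ⬝ᵥ K *ᵥ v := by
  rw [trace_mul_comm, mul_vecMulVec, trace_vecMulVec, dotProduct_comm]

/-- A positive definite matrix has a root `Z L` with `Z` block diagonal and invertible, and `L`
positive definite with identity diagonal blocks. -/
lemma IsPVM.exists_block_root (h : IsPVM E) {G : Matrix ι ι ℂ} (hG : G.PosDef) :
    ∃ Z L : Matrix ι ι ℂ, (∀ i, E i * Z = Z * E i) ∧ IsUnit Z ∧ L.PosDef ∧
      (∀ i, E i * L * E i = E i) ∧ (Z * L)ᴴ * (Z * L) = G := by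
  classical
  obtain ⟨S, hS⟩ := CStarAlgebra.nonneg_iff_eq_star_mul_self.mp hG.posSemidef.nonneg
  rw [star_eq_conjTranspose] at hS
  -- All matrices `W S` with `W` unitary are roots of `G`; by compactness one has a block-diagonal
  -- part of maximal Hilbert–Schmidt norm.
  obtain ⟨W₀, hW₀, hmax₀⟩ := (isCompact_unitary (ι := ι)).exists_isMaxOn ⟨1, by simp⟩
    (f := fun W => hsSq (pinch E (W * S))) (Continuous.continuousOn
      (continuous_hsSq.comp ((continuous_pinch E).comp (by fun_prop))))
  have hW₀' : W₀ᴴ * W₀ = 1 := hW₀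
  obtain ⟨Y, hYdef⟩ : ∃ Y, Y = W₀ * S := ⟨_, rfl⟩
  have hY : Yᴴ * Y = G := by
    rw [hYdef, hS, conjTranspose_mul, mul_assoc, ← mul_assoc W₀ᴴ, hW₀', one_mul]
  have hmax : ∀ W : Matrix ι ι ℂ, Wᴴ * W = 1 → hsSq (pinch E (W * Y)) ≤ hsSq (pinch E Y) := by
    intro W hW
    rw [hYdef, ← mul_assoc]
    refine hmax₀ (show (W * W₀)ᴴ * (W * W₀) = 1 from ?_)
    rw [conjTranspose_mul, mul_assoc, ← mul_assoc Wᴴ, hW, one_mul, hW₀']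
  have hYu : IsUnit Y := by
    have := hG.isUnit
    rw [← hY, isUnit_iff_isUnit_det, det_mul] at this
    rw [isUnit_iff_isUnit_det]
    exact isUnit_of_mul_isUnit_right this
  have hvar := fun p hp => h.variation hmax (p := p) hp
  have hK : (Y * (pinch E Y)ᴴ).PosSemidef := by
    refine posSemidef_of_forall_nonneg fun v => ?_
    by_cases hv : v = 0
    · simp [hv]
    have h1 := (hvar _ (isStarProjection_vecMulVec hv)).1
    rw [smul_mul_assoc, trace_smul, trace_vecMulVec_mul, smul_eq_mul] at h1
    have h2 : 0 < star v ⬝ᵥ v := dotProduct_star_self_pos_iff.2 hv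
    have h3 := mul_nonneg h2.le h1
    rwa [← mul_assoc, mul_inv_cancel₀ h2.ne', one_mul] at h3
  have hKs : pinch E Y * Yᴴ = Y * (pinch E Y)ᴴ := by
    have := hK.isHermitian.eq
    rwa [conjTranspose_mul, conjTranspose_conjTranspose] at this
  -- For `p` the projector on `r` the linear term vanishes, hence so does `pinch (p Y)`. Each block
  -- of this rank-one matrix is an outer product, so one of its two vectors is zero.
  have hker : ∀ r, (pinch E Y)ᴴ *ᵥ r = 0 → ∀ i, E i *ᵥ r = 0 ∨ E i *ᵥ (Yᴴ *ᵥ r) = 0 := by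
    intro r hr i
    by_cases hr0 : r = 0
    · simp [hr0]
    have h1 := (hvar _ (isStarProjection_vecMulVec hr0)).2
    rw [smul_mul_assoc, smul_mul_assoc, trace_smul, trace_vecMulVec_mul, ← mulVec_mulVec, hr] at h1
    simp only [mulVec_zero, dotProduct_zero, smul_zero, Complex.zero_re] at h1
    have h2 := hsSq_eq_zero (le_antisymm h1 (hsSq_nonneg _))
    rw [pinch_smul, smul_eq_zero] at h2
    have h3 : pinch E (vecMulVec r (star r) * Y) = 0 := by
      rcases h2 with h2 | h2
      · exact absurd h2 (inv_ne_zero (dotProduct_star_self_pos_iff.2 hr0).ne')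
      · exact h2
    have h4 := h.mul_pinch i (vecMulVec r (star r) * Y)
    rw [h3, mul_zero, ← mul_assoc, mul_vecMulVec, vecMulVec_mul, vecMulVec_mul] at h4
    rcases vecMulVec_eq_zero.1 h4.symm with h5 | h5
    · exact Or.inl h5
    · right
      have h6 := congrArg star h5
      rw [star_vecMul, star_vecMul, star_star, star_zero, h.conjTranspose] at h6
      exact h6
  have hZu : IsUnit (pinch E Y) := by
    -- Suppose `Z† r = 0` with `Z = pinch E Y`. Symmetry of `Y Z†` gives `Z Y† r = 0`, so in some
    -- block `i` where `Y† r` is nonzero and `r` vanishes, the block of `Z` is singular. Its adjoint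
    -- then has a kernel vector `s` in the same block, and `r + s` violates the dichotomy of `hker`.
    by_contra hcon
    have hdet : ((pinch E Y)ᴴ).det = 0 := by
      rw [isUnit_iff_isUnit_det, isUnit_iff_ne_zero, not_not] at hcon
      rw [det_conjTranspose, hcon, star_zero]
    obtain ⟨r, hr0, hr⟩ := exists_mulVec_eq_zero_iff.2 hdet
    obtain ⟨u, hu⟩ : ∃ u, u = Yᴴ *ᵥ r := ⟨_, rfl⟩
    have hu0 : u ≠ 0 := by
      intro h0
      rw [hu] at h0
      have : (Yᴴ).det = 0 := exists_mulVec_eq_zero_iff.1 ⟨r, hr0, h0⟩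
      have h2 : IsUnit Yᴴ := by
        rw [← star_eq_conjTranspose]; exact hYu.star
      rw [isUnit_iff_isUnit_det, this] at h2
      simp at h2
    obtain ⟨i, hi⟩ : ∃ i, E i *ᵥ u ≠ 0 := by
      by_contra! hall
      apply hu0
      rw [← h.sum_mulVec u]
      exact Finset.sum_eq_zero fun i _ => hall i
    have hri : E i *ᵥ r = 0 := by
      rcases hker r hr i with h1 | h1
      · exact h1
      · rw [← hu] at h1; exact absurd h1 hi
    have hYu0 : (E i * Y * E i) *ᵥ u = 0 := by
      rw [← h.mul_pinch, ← mulVec_mulVec, hu, mulVec_mulVec _ (pinch E Y), hKs, ← mulVec_mulVec,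
        hr]
      simp
    -- Completing the block by the identity elsewhere lets the determinant transfer singularity to
    -- the adjoint block.
    have hdet2 : (E i * Y * E i + (1 - E i)).det = 0 := by
      refine exists_mulVec_eq_zero_iff.1 ⟨E i *ᵥ u, hi, ?_⟩
      rw [mulVec_mulVec, add_mul, mul_assoc (E i * Y), h.mul_self, sub_mul, one_mul, h.mul_self,
        sub_self, add_zero, hYu0]
    have hdet3 : (E i * Yᴴ * E i + (1 - E i)).det = 0 := by
      have h1 : E i * Yᴴ * E i + (1 - E i) = (E i * Y * E i + (1 - E i))ᴴ := by
        simp [h.conjTranspose, mul_assoc]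
      rw [h1, det_conjTranspose, hdet2, star_zero]
    obtain ⟨s, hs0, hs⟩ := exists_mulVec_eq_zero_iff.2 hdet3
    have hs1 : E i *ᵥ s = s := by
      have h1 := congrArg (fun w => (1 - E i) *ᵥ w) hs
      simp only [mulVec_mulVec, mulVec_zero] at h1
      have h2 : (1 - E i) * (E i * Yᴴ * E i + (1 - E i)) = 1 - E i := by
        simp only [mul_add, sub_mul, one_mul, mul_sub, mul_one, ← mul_assoc, h.mul_self]
        abel
      rw [h2, sub_mulVec, one_mulVec, sub_eq_zero] at h1
      exact h1.symm
    have hs2 : (pinch E Y)ᴴ *ᵥ s = 0 := by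
      rw [add_mulVec, sub_mulVec, one_mulVec, hs1, sub_self, add_zero] at hs
      rw [← hs1, h.pinch_conjTranspose, mulVec_mulVec, h.pinch_mul]
      exact hs
    have hs3 : E i *ᵥ (Yᴴ *ᵥ s) = 0 := by
      rcases hker s hs2 i with h1 | h1
      · exact absurd (hs1.symm.trans h1) hs0
      · exact h1
    rcases hker (r + s) (by rw [mulVec_add, hr, hs2, add_zero]) i with h1 | h1
    · rw [mulVec_add, hri, hs1, zero_add] at h1
      exact hs0 h1
    · rw [mulVec_add, mulVec_add, hs3, add_zero, ← hu] at h1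
      exact hi h1
  set Z := pinch E Y with hZ
  have hZc : ∀ i, E i * Z = Z * E i := fun i => by rw [hZ, h.mul_pinch, h.pinch_mul]
  have hZd := (isUnit_iff_isUnit_det Z).1 hZu
  have hZi : Z⁻¹ * Z = 1 := nonsing_inv_mul _ hZd
  have hZi' : Z * Z⁻¹ = 1 := mul_nonsing_inv _ hZd
  have hZic : ∀ i, E i * Z⁻¹ = Z⁻¹ * E i := fun i => by
    calc E i * Z⁻¹ = Z⁻¹ * Z * E i * Z⁻¹ := by rw [hZi, one_mul]
      _ = Z⁻¹ * (Z * E i) * Z⁻¹ := by simp only [mul_assoc]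
      _ = Z⁻¹ * E i * (Z * Z⁻¹) := by rw [← hZc]; simp only [mul_assoc]
      _ = _ := by rw [hZi', mul_one]
  -- This exhibits `L = Z⁻¹ Y` as a congruence of the positive matrix `Y Z†`.
  have hLeq : Z⁻¹ * Y = Z⁻¹ * (Y * Zᴴ) * (Z⁻¹)ᴴ := by
    rw [mul_assoc, mul_assoc, ← conjTranspose_mul, hZi, conjTranspose_one, mul_one]
  have hLu : IsUnit (Z⁻¹ * Y) := by
    refine IsUnit.mul ?_ hYu
    exact (isUnit_nonsing_inv_iff).2 hZu
  have hLp : (Z⁻¹ * Y).PosSemidef := by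
    rw [hLeq]; exact hK.mul_mul_conjTranspose_same _
  refine ⟨Z, Z⁻¹ * Y, hZc, hZu, (hLp.posDef_iff_isUnit).2 hLu, fun i => ?_, ?_⟩
  · rw [← h.mul_pinch, pinch_mul_of_commute hZic, ← hZ, hZi, mul_one]
  · rw [← mul_assoc Z, hZi', one_mul, hY]

end BlockRoot

/-! ### The Lyapunov equation -/

section Lyapunov

variable {ι : Type*} [Fintype ι] [DecidableEq ι]

lemma posDef_diagonalization {H : Matrix ι ι ℂ} (hH : H.PosDef) :
    ∃ (U : Matrix ι ι ℂ) (v : ι → ℝ), (∀ i, 0 < v i) ∧ Uᴴ * U = 1 ∧ U * Uᴴ = 1 ∧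
      H = U * diagonal (fun i => (v i : ℂ)) * Uᴴ := by
  refine ⟨hH.isHermitian.eigenvectorUnitary, hH.isHermitian.eigenvalues, hH.eigenvalues_pos,
    Unitary.coe_star_mul_self hH.isHermitian.eigenvectorUnitary,
    Unitary.coe_mul_star_self hH.isHermitian.eigenvectorUnitary, ?_⟩
  have := hH.isHermitian.spectral_theorem
  rw [Unitary.conjStarAlgAut_apply] at this
  exact this

/-- In an eigenbasis of `H` the equation multiplies the entry `(a, b)` by `v a + v b > 0`. -/
lemma lyapunov_unique {H X : Matrix ι ι ℂ} (hH : H.PosDef) (h : H * X + X * H = 0) : X = 0 := by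
  obtain ⟨U, v, hv, h1, h2, rfl⟩ := posDef_diagonalization hH
  set D := diagonal (fun i => (v i : ℂ)) with hD
  have h3 : D * (Uᴴ * X * U) + (Uᴴ * X * U) * D = 0 := by
    calc D * (Uᴴ * X * U) + (Uᴴ * X * U) * D
        = (Uᴴ * U) * D * (Uᴴ * X * U) + (Uᴴ * X * U) * D * (Uᴴ * U) := by rw [h1]; simp
      _ = Uᴴ * (U * D * Uᴴ * X + X * (U * D * Uᴴ)) * U := by
          simp only [mul_add, add_mul, mul_assoc]
      _ = 0 := by rw [h]; simp
  have h4 : Uᴴ * X * U = 0 := by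
    ext a b
    have h5 := congrFun (congrFun h3 a) b
    rw [Matrix.add_apply, hD, diagonal_mul, mul_diagonal, mul_comm _ (v b : ℂ), ← add_mul,
      Matrix.zero_apply, mul_eq_zero] at h5
    rcases h5 with h5 | h5
    · have : v a + v b = 0 := by exact_mod_cast h5
      linarith [hv a, hv b]
    · simpa using h5
  calc X = (U * Uᴴ) * X * (U * Uᴴ) := by rw [h2]; simp
    _ = U * (Uᴴ * X * U) * Uᴴ := by simp only [mul_assoc]
    _ = 0 := by rw [h4]; simp

lemma lyapunov_exists {H : Matrix ι ι ℂ} (hH : H.PosDef) (R : Matrix ι ι ℂ) :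
    ∃ S, H * S + S * H = R := by
  have hinj : Function.Injective
      (LinearMap.mulLeft ℂ H + LinearMap.mulRight ℂ H : Matrix ι ι ℂ →ₗ[ℂ] Matrix ι ι ℂ) := by
    rw [injective_iff_map_eq_zero]
    intro X hX
    exact lyapunov_unique hH (by simpa using hX)
  obtain ⟨S, hS⟩ := LinearMap.surjective_of_injective hinj R
  exact ⟨S, by simpa using hS⟩

lemma lyapunov_posSemidef {H R S : Matrix ι ι ℂ} (hH : H.PosDef) (hR : R.PosSemidef)
    (h : H * S + S * H = R) : S.PosSemidef := by
  have hS : S.IsHermitian := by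
    refine sub_eq_zero.1 (lyapunov_unique hH ?_)
    have h1 : Sᴴ * H + H * Sᴴ = R := by
      rw [← hR.isHermitian.eq, ← h]
      simp [hH.isHermitian.eq]
    calc H * (Sᴴ - S) + (Sᴴ - S) * H = (Sᴴ * H + H * Sᴴ) - (H * S + S * H) := by
          simp only [mul_sub, sub_mul]; abel
      _ = 0 := by rw [h1, h, sub_self]
  rw [hS.posSemidef_iff_eigenvalues_nonneg]
  intro j
  set v : ι → ℂ := (hS.eigenvectorBasis j).ofLp with hv
  set lam := hS.eigenvalues j with hlam
  have he : S *ᵥ v = lam • v := hS.mulVec_eigenvectorBasis j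
  have hv0 : v ≠ 0 := by
    intro h0
    apply hS.eigenvectorBasis.toBasis.ne_zero j
    ext i
    simpa using congrFun h0 i
  have he' : star v ᵥ* S = lam • star v := by
    have := congrArg star he
    rwa [star_mulVec, hS.eq, star_smul, star_trivial lam] at this
  -- On an eigenvector of `S` the equation reads `⟨v, R v⟩ = 2 λ ⟨v, H v⟩`, which fixes the sign of
  -- `λ`.
  have h1 : star v ⬝ᵥ R *ᵥ v = (2 * lam : ℝ) • (star v ⬝ᵥ H *ᵥ v) := by
    rw [← h, add_mulVec, dotProduct_add, ← mulVec_mulVec, he, ← mulVec_mulVec, dotProduct_mulVec _ S,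
      he', mulVec_smul, dotProduct_smul, smul_dotProduct, two_mul, add_smul]
  have h2 := hR.dotProduct_mulVec_nonneg v
  have h3 := hH.dotProduct_mulVec_pos hv0
  have h4 := (Complex.nonneg_iff.1 h2).1
  have h5 := (Complex.pos_iff.1 h3).1
  rw [h1, Complex.smul_re, smul_eq_mul] at h4
  have h6 := nonneg_of_mul_nonneg_left h4 h5
  change 0 ≤ lam
  linarith

/-- An off-diagonal block of the solution of a Lyapunov equation with positive right-hand side. -/
lemma traceNorm_lyapunov_block_le {H R E k : Matrix ι ι ℂ} (hH : H.PosDef) (hR : R.PosSemidef)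
    (hE : IsStarProjection E) (hHE : E * H = H * E) (h : H * k + k * H = E * R * (1 - E)) :
    traceNorm k ≤ (H⁻¹ * R).trace.re / 4 := by
  obtain ⟨S, hS⟩ := lyapunov_exists hH R
  have hSp := lyapunov_posSemidef hH hR hS
  have hHQ : (1 - E) * H = H * (1 - E) := by simp [sub_mul, mul_sub, hHE]
  -- As `H` commutes with `E`, the corner of the full solution solves the corner equation;
  -- uniqueness identifies it with `k`.
  have hk : k = E * S * (1 - E) := by
    refine sub_eq_zero.1 (lyapunov_unique hH ?_)
    have h1 : H * (E * S * (1 - E)) + (E * S * (1 - E)) * H = E * R * (1 - E) := by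
      rw [mul_assoc (E * S), hHQ, ← hS, ← mul_assoc, ← mul_assoc, ← hHE]
      simp only [mul_add, add_mul, mul_assoc]
    calc _ = (H * k + k * H) - (H * (E * S * (1 - E)) + (E * S * (1 - E)) * H) := by
          simp only [mul_sub, sub_mul]; abel
      _ = 0 := by rw [h1, h, sub_self]
  have hdet := (isUnit_iff_isUnit_det H).1 hH.isUnit
  have ht : (H⁻¹ * R).trace = 2 * S.trace := by
    rw [← hS, mul_add, trace_add, ← mul_assoc, nonsing_inv_mul _ hdet, one_mul, ← mul_assoc,
      trace_mul_comm, ← mul_assoc, mul_nonsing_inv _ hdet, one_mul]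
    ring
  rw [ht, hk]
  refine (traceNorm_offDiag_le hSp hE).trans (le_of_eq ?_)
  simp
  ring

end Lyapunov

/-! ### The block estimate -/

section BlockEstimate

variable {κ ι μ : Type*} [Fintype κ] [Fintype ι] [Fintype μ] [DecidableEq ι]

/-- The real quadratic form `z ↦ Tr z† M z`. -/
def quad (M : Matrix ι ι ℂ) (z : Matrix ι μ ℂ) : ℝ := (zᴴ * M * z).trace.re

lemma quad_nonneg {M : Matrix ι ι ℂ} (hM : M.PosSemidef) (z : Matrix ι μ ℂ) : 0 ≤ quad M z :=
  PosSemidef_trace_re_nonneg (hM.conjTranspose_mul_mul_same z)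

lemma quad_eq (M : Matrix ι ι ℂ) (z : Matrix ι μ ℂ) : quad M z = (M * (z * zᴴ)).trace.re := by
  rw [quad, Matrix.mul_assoc, trace_mul_comm, Matrix.mul_assoc]

/-- Expand the nonnegative quantity `quad L⁻¹ (z - L y)`. This is the variational bound for `L⁻¹`,
with `y` a free test matrix. -/
lemma two_re_trace_le_quad {L : Matrix ι ι ℂ} (hL : L.PosDef) (y z : Matrix ι μ ℂ) :
    2 * (yᴴ * z).trace.re ≤ quad L⁻¹ z + quad L y := by
  have h := quad_nonneg hL.inv.posSemidef (z - L * y)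
  have hdet := (isUnit_iff_isUnit_det L).1 hL.isUnit
  have h1 : (zᴴ * y).trace.re = (yᴴ * z).trace.re := by
    rw [← re_trace_conjTranspose]; simp
  have h2 : (z - L * y)ᴴ * L⁻¹ * (z - L * y) = zᴴ * L⁻¹ * z - zᴴ * y - yᴴ * z + yᴴ * L * y := by
    have e1 : L⁻¹ * (L * y) = y := by
      rw [← Matrix.mul_assoc, nonsing_inv_mul _ hdet, Matrix.one_mul]
    have e2 : L * (L⁻¹ * z) = z := by
      rw [← Matrix.mul_assoc, mul_nonsing_inv _ hdet, Matrix.one_mul]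
    simp only [conjTranspose_sub, conjTranspose_mul, hL.isHermitian.eq, Matrix.sub_mul,
      Matrix.mul_sub, Matrix.mul_assoc, e1, e2]
    abel
  rw [quad, h2] at h
  simp only [trace_add, trace_sub, Complex.add_re, Complex.sub_re, h1] at h
  simp only [quad]
  linarith

/-- Replacing a diagonal block of `L` by a decoupled identity. -/
lemma posDef_decouple {L E : Matrix ι ι ℂ} (hL : L.PosDef) (hE : IsStarProjection E)
    (hEL : E * L * E = E) : (E + (1 - E) * L * (1 - E)).PosDef := by
  have h1 : Eᴴ = E := hE.isSelfAdjoint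
  have h2 : E * E = E := hE.isIdempotentElem
  have hV : (2 * E - 1)ᴴ = 2 * E - 1 := by
    rw [two_mul, conjTranspose_sub, conjTranspose_add, h1, conjTranspose_one]
  -- Averaging `L` with its conjugate by the reflection `2E - 1` removes the off-diagonal blocks.
  have e : E + (1 - E) * L * (1 - E)
      = (1 / 2 : ℂ) • (L + (2 * E - 1) * L * (2 * E - 1)ᴴ) := by
    rw [hV]
    have : L + (2 * E - 1) * L * (2 * E - 1) = (2 : ℂ) • (E * L * E + (1 - E) * L * (1 - E)) := by
      rw [two_smul]
      noncomm_ring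
    rw [this, smul_smul, hEL]
    norm_num
  rw [e]
  refine (hL.add_posSemidef ?_).smul (by norm_num)
  exact hL.posSemidef.mul_mul_conjTranspose_same _

/-- The inverse of a compression is dominated by the inverse of the whole: use the variational bound
for `L⁻¹` with the complementary part of `M⁻¹ z` as test matrix. -/
lemma quad_decouple_inv_le {L E : Matrix ι ι ℂ} (hL : L.PosDef) (hE : IsStarProjection E)
    (hEL : E * L * E = E) (z : Matrix ι μ ℂ) :
    quad (E + (1 - E) * L * (1 - E))⁻¹ z ≤ hsSq (E * z) + quad L⁻¹ z := by
  have h1 : Eᴴ = E := hE.isSelfAdjoint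
  have h2 : E * E = E := hE.isIdempotentElem
  have hM := posDef_decouple hL hE hEL
  set M := E + (1 - E) * L * (1 - E) with hMdef
  have hdet := (isUnit_iff_isUnit_det M).1 hM.isUnit
  have hEM : E * M = E := by
    have h3 : E * (1 - E) = 0 := by rw [mul_sub, mul_one, h2, sub_self]
    rw [hMdef, mul_add, h2, ← mul_assoc, ← mul_assoc, h3]
    simp
  obtain ⟨w, hw⟩ : ∃ w, w = M⁻¹ * z := ⟨_, rfl⟩
  have hMw : M * w = z := by rw [hw, ← Matrix.mul_assoc, mul_nonsing_inv _ hdet, Matrix.one_mul]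
  have hEw : E * w = E * z := by rw [← hMw, ← Matrix.mul_assoc, hEM]
  have key := two_re_trace_le_quad hL ((1 - E) * w) z
  have a1 : quad M⁻¹ z = (wᴴ * z).trace.re := by
    rw [quad, hw, conjTranspose_mul, hM.inv.isHermitian.eq]
  have a2 : (wᴴ * E * z).trace.re = hsSq (E * z) := by
    rw [← hsSq_conjTranspose, hsSq, conjTranspose_conjTranspose]
    nth_rewrite 1 [← hEw]
    rw [conjTranspose_mul, h1, Matrix.mul_assoc, Matrix.mul_assoc, ← Matrix.mul_assoc E, h2]
  have a3 : (((1 - E) * w)ᴴ * z).trace.re = quad M⁻¹ z - hsSq (E * z) := by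
    rw [a1, ← a2, conjTranspose_mul, conjTranspose_sub, conjTranspose_one, h1, Matrix.mul_sub,
      Matrix.sub_mul, Matrix.mul_one, trace_sub, Complex.sub_re]
  have a4 : quad L ((1 - E) * w) = quad M⁻¹ z - hsSq (E * z) := by
    have : ((1 - E) * w)ᴴ * L * ((1 - E) * w) = wᴴ * z - wᴴ * E * z := by
      calc ((1 - E) * w)ᴴ * L * ((1 - E) * w) = wᴴ * ((1 - E) * L * (1 - E)) * w := by
            rw [conjTranspose_mul, conjTranspose_sub, conjTranspose_one, h1]
            simp only [Matrix.mul_assoc]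
        _ = wᴴ * (M - E) * w := by rw [hMdef]; simp
        _ = wᴴ * (M * w) - wᴴ * (E * w) := by
            rw [Matrix.mul_sub, Matrix.sub_mul, Matrix.mul_assoc, Matrix.mul_assoc]
        _ = _ := by rw [hMw, hEw, Matrix.mul_assoc]
    rw [quad, this, a1, ← a2, trace_sub, Complex.sub_re]
  rw [a3, a4] at key
  linarith

/-- A root `Y` of a positive definite matrix whose blocks are perturbed by cross terms: the
off-diagonal blocks of `Y` and the coherences they generate are controlled by the perturbation. -/
lemma IsPVM.exists_root_block_estimate {E : κ → Matrix ι ι ℂ} (h : IsPVM E) {Δ G : Matrix ι ι ℂ}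
    (hΔ : Δ.PosDef) (hΔc : ∀ i, E i * Δ = Δ * E i) (β : κ → κ → Matrix ι μ ℂ)
    (hβ : ∀ i j, E i * β i j = β i j) (hβ0 : ∀ i, β i i = 0)
    (hG : G = Δ + ∑ i, ∑ j, β i j * (β i j)ᴴ + ∑ i, ∑ j, β i j * (β j i)ᴴ) :
    ∃ Y : Matrix ι ι ℂ, IsUnit Y ∧ Yᴴ * Y = G ∧
      ∑ i, (hsSq ((1 - E i) * Y * E i) + traceNorm (E i * Y * E i * Yᴴ * (1 - E i)))
        ≤ ∑ i, ∑ j, hsSq (β i j) := by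
  classical
  have hEne : ∀ i a b, i ≠ a → E i * β a b = 0 := by
    intro i a b hia
    rw [← hβ a b, ← Matrix.mul_assoc, h.orthogonal i a hia, Matrix.zero_mul]
  -- The symmetric combinations `z i j` complete squares: the perturbation is half of `∑ z z†`,
  -- which makes `G` positive definite.
  obtain ⟨z, hz⟩ : ∃ z : κ → κ → Matrix ι μ ℂ, ∀ i j, z i j = β i j + β j i := ⟨_, fun _ _ => rfl⟩
  have hEz : ∀ i j, E i * z i j = β i j := by
    intro i j
    rw [hz, Matrix.mul_add, hβ]
    rcases eq_or_ne i j with rfl | hij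
    · rw [hβ, hβ0, add_zero]
    · rw [hEne i j i hij, add_zero]
  have hQz : ∀ i j, (1 - E i) * z i j = β j i := by
    intro i j
    rw [Matrix.sub_mul, Matrix.one_mul, hEz, hz, add_sub_cancel_left]
  have hzz : ∀ i j, E i * (z i j * (z i j)ᴴ) * (1 - E i) = β i j * (β j i)ᴴ := by
    intro i j
    rw [← hQz i j, conjTranspose_mul, conjTranspose_sub, conjTranspose_one, h.conjTranspose,
      ← Matrix.mul_assoc, hEz, Matrix.mul_assoc]
  have hzsum : ∑ i, ∑ j, z i j * (z i j)ᴴ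
      = (2 : ℂ) • (∑ i, ∑ j, β i j * (β i j)ᴴ + ∑ i, ∑ j, β i j * (β j i)ᴴ) := by
    have e1 : ∑ i, ∑ j, β j i * (β j i)ᴴ = ∑ i, ∑ j, β i j * (β i j)ᴴ := Finset.sum_comm
    have e2 : ∑ i, ∑ j, β j i * (β i j)ᴴ = ∑ i, ∑ j, β i j * (β j i)ᴴ := Finset.sum_comm
    simp only [hz, conjTranspose_add, Matrix.mul_add, Matrix.add_mul, Finset.sum_add_distrib, e1,
      e2, two_smul]
    abel
  have hGz : (2 : ℂ) • G = (2 : ℂ) • Δ + ∑ i, ∑ j, z i j * (z i j)ᴴ := by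
    rw [hzsum, hG, ← smul_add, add_assoc]
  have hGp : G.PosDef := by
    have e : G = Δ + (1 / 2 : ℂ) • ∑ i, ∑ j, z i j * (z i j)ᴴ := by
      rw [hzsum, smul_smul, hG, add_assoc]; norm_num
    rw [e]
    refine hΔ.add_posSemidef (PosSemidef.smul ?_ (by rw [Complex.nonneg_iff]; norm_num))
    exact posSemidef_sum _ fun i _ => posSemidef_sum _ fun j _ => posSemidef_self_mul_conjTranspose _
  obtain ⟨Z, L, hZc, hZu, hL, hEL, hGeq⟩ := h.exists_block_root hGp
  have hZc' : ∀ i, E i * Zᴴ = Zᴴ * E i := fun i => by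
    have := congrArg Matrix.conjTranspose (hZc i)
    simpa [h.conjTranspose] using this.symm
  have hLs : Lᴴ = L := hL.isHermitian
  have hGL : G = L * (Zᴴ * Z) * L := by rw [← hGeq, conjTranspose_mul, hLs]; simp only [mul_assoc]
  have hBc : ∀ i, E i * (Zᴴ * Z) = (Zᴴ * Z) * E i := fun i => by
    rw [← mul_assoc, hZc', mul_assoc, hZc, mul_assoc]
  have hdetL := (isUnit_iff_isUnit_det L).1 hL.isUnit
  have hdetZ := (isUnit_iff_isUnit_det Z).1 hZu
  have hZhu : IsUnit Zᴴ := by rw [← star_eq_conjTranspose]; exact hZu.star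
  have hdetZh := (isUnit_iff_isUnit_det Zᴴ).1 hZhu
  refine ⟨Z * L, hZu.mul hL.isUnit, hGeq, ?_⟩
  obtain ⟨ν, hν⟩ : ∃ ν, ν = ∑ i, ∑ j, hsSq (β i j) := ⟨_, rfl⟩
  obtain ⟨τ, hτ⟩ : ∃ τ, τ = (Zᴴ * Z).trace.re := ⟨_, rfl⟩
  have hpinchL : pinch E L = 1 := by simp only [pinch, hEL, h.complete]
  have htrG : G.trace.re = Δ.trace.re + ν := by
    have e : ∀ i j, (β i j * (β j i)ᴴ).trace = 0 := by
      intro i j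
      rcases eq_or_ne i j with rfl | hij
      · simp [hβ0]
      · rw [← hβ i j, ← hβ j i, conjTranspose_mul, h.conjTranspose, trace_mul_comm,
          Matrix.mul_assoc, ← Matrix.mul_assoc (E j), h.orthogonal j i hij.symm]
        simp
    rw [hG, hν]
    simp only [trace_add, trace_sum, e, Finset.sum_const_zero, add_zero, Complex.add_re,
      Complex.re_sum, hsSq]
  -- Since `G = L (Z†Z) L`, this is the trace of `Z†Z L`, where only the identity diagonal blocks of
  -- `L` count.
  have htrLG : (L⁻¹ * G).trace.re = τ := by
    rw [hGL, ← mul_assoc, ← mul_assoc, nonsing_inv_mul _ hdetL, one_mul, ← h.trace_pinch,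
      pinch_mul_of_commute hBc, hpinchL, mul_one, hτ]
  have htrLΔ : Δ.trace.re ≤ (L⁻¹ * Δ).trace.re := by
    obtain ⟨C, hC⟩ := CStarAlgebra.nonneg_iff_eq_star_mul_self.mp hΔ.posSemidef.nonneg
    have e : Δ = Cᴴ * (Cᴴ)ᴴ := by rw [hC, star_eq_conjTranspose, conjTranspose_conjTranspose]
    have h1 := two_re_trace_le_quad hL Cᴴ Cᴴ
    rw [quad_eq, quad_eq, ← e, trace_mul_comm, ← e] at h1
    have h2 : (L * Δ).trace = Δ.trace := by
      rw [trace_mul_comm, ← h.trace_pinch, pinch_mul_of_commute hΔc, hpinchL, mul_one]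
    rw [h2] at h1
    linarith
  have hquad : ∑ i, ∑ j, quad L⁻¹ (z i j) = 2 * (τ - (L⁻¹ * Δ).trace.re) := by
    have h1 := congrArg (fun X => (L⁻¹ * X).trace.re) hGz
    simp only [mul_add, Matrix.mul_smul, trace_add, trace_smul, Finset.mul_sum, trace_sum,
      Complex.add_re, Complex.re_sum, smul_eq_mul] at h1
    have e2 : ∀ w : ℂ, ((2 : ℂ) * w).re = 2 * w.re := fun w => by simp
    rw [e2, e2, htrLG] at h1
    simp only [quad_eq]
    linarith
  -- Leakage is the squared norm of `Y` minus that of its block-diagonal part `Z`.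
  have hεsum : ∑ i, hsSq ((1 - E i) * (Z * L) * E i) = G.trace.re - τ := by
    have e : ∀ i, hsSq ((1 - E i) * (Z * L) * E i)
        = (E i * G * E i).trace.re - (E i * (Zᴴ * Z) * E i).trace.re := by
      intro i
      have e1 : E i * (Z * L) * E i = Z * E i := by
        rw [← mul_assoc, hZc, mul_assoc, mul_assoc, ← mul_assoc (E i), hEL]
      have e2 : (1 - E i) * (Z * L) * E i = Z * L * E i - Z * E i := by
        rw [sub_mul, sub_mul, one_mul, e1]
      have e3 : E i * (Lᴴ * Zᴴ) * (Z * E i) = E i * (Zᴴ * Z) * E i := by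
        have : E i * (Lᴴ * Zᴴ) * E i = E i * Zᴴ := by
          have := congrArg Matrix.conjTranspose e1
          simpa [h.conjTranspose, mul_assoc] using this
        rw [← hZc, ← mul_assoc, this, mul_assoc, hBc, mul_assoc _ (E i) (E i), h.mul_self]
      have e4 : ((1 - E i) * (Z * L) * E i)ᴴ * ((1 - E i) * (Z * L) * E i)
          = E i * G * E i - E i * (Zᴴ * Z) * E i := by
        have f1 : E i * Zᴴ * (Z * L * E i) = E i * (Zᴴ * Z) * E i := by
          rw [← e3]
          have := congrArg Matrix.conjTranspose e3
          have e5 : (E i * (Lᴴ * Zᴴ) * (Z * E i))ᴴ = E i * Zᴴ * (Z * L * E i) := by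
            simp [h.conjTranspose, mul_assoc]
          have e6 : (E i * (Zᴴ * Z) * E i)ᴴ = E i * (Zᴴ * Z) * E i := by
            simp [h.conjTranspose, mul_assoc]
          rw [e5, e6] at this
          rw [this, e3]
        have f2 : E i * Zᴴ * (Z * E i) = E i * (Zᴴ * Z) * E i := by simp only [mul_assoc]
        have f3 : E i * (Lᴴ * Zᴴ) * (Z * L * E i) = E i * G * E i := by
          rw [← hGeq, conjTranspose_mul]; simp only [mul_assoc]
        rw [e2, conjTranspose_sub, conjTranspose_mul (Z * L), conjTranspose_mul Z,
          conjTranspose_mul Z, h.conjTranspose, sub_mul, mul_sub, mul_sub, e3, f1, f2, f3]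
        abel
      rw [← hsSq_conjTranspose, hsSq, conjTranspose_conjTranspose, e4, trace_sub, Complex.sub_re]
    simp only [e, Finset.sum_sub_distrib, ← Complex.re_sum, ← trace_sum]
    rw [hτ, ← h.trace_pinch G, ← h.trace_pinch (Zᴴ * Z)]
    rfl
  have hlow : ν ≤ ∑ i, ∑ j, quad L⁻¹ (z i j) := by
    rw [hν, Finset.sum_comm]
    refine Finset.sum_le_sum fun i _ => Finset.sum_le_sum fun j _ => ?_
    have h1 := two_re_trace_le_quad hL (β j i) (z i j)
    have h2 : ((β j i)ᴴ * z i j).trace.re = hsSq (β j i) := by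
      rw [← hsSq_conjTranspose, hsSq, conjTranspose_conjTranspose]
      conv_lhs => rw [← hβ j i]
      have : z i j = z j i := by rw [hz, hz, add_comm]
      rw [conjTranspose_mul, h.conjTranspose, Matrix.mul_assoc, this, hEz]
    have h3 : quad L (β j i) = hsSq (β j i) := by
      rw [← hsSq_conjTranspose, hsSq, conjTranspose_conjTranspose, quad]
      conv_lhs => rw [← hβ j i]
      have : (E j * β j i)ᴴ * L * (E j * β j i) = (β j i)ᴴ * ((E j * L * E j) * β j i) := by
        rw [conjTranspose_mul, h.conjTranspose]; simp only [Matrix.mul_assoc]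
      rw [this, hEL, hβ]
    rw [h2, h3] at h1
    linarith
  -- The coherence is `E (Z L Z†) Q`, with `Q = 1 - E`. With `M = E + Q L Q`, obtained by decoupling
  -- block `i` of `L`, it solves a Lyapunov equation for `H = Z M Z†`; the source is a corner of `Z
  -- R Z†`, where `R = ∑ j, z i j (z i j)†` has the same corner as `G`.
  have hk : ∀ i, traceNorm (E i * (Z * L) * E i * (Z * L)ᴴ * (1 - E i))
      ≤ (∑ j, (hsSq (β i j) + quad L⁻¹ (z i j))) / 4 := by
    intro i
    have hM := posDef_decouple hL (h.projection i) (hEL i)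
    have hzq : ∀ j, quad (E i + (1 - E i) * L * (1 - E i))⁻¹ (z i j)
        ≤ hsSq (β i j) + quad L⁻¹ (z i j) := fun j => by
      have := quad_decouple_inv_le hL (h.projection i) (hEL i) (z i j)
      rwa [hEz] at this
    obtain ⟨Q, hQ⟩ : ∃ Q, Q = 1 - E i := ⟨_, rfl⟩
    have hEQ : E i * Q = 0 := by rw [hQ, mul_sub, mul_one, h.mul_self, sub_self]
    have hQE : Q * E i = 0 := by rw [hQ, sub_mul, one_mul, h.mul_self, sub_self]
    have hQQ : Q * Q = Q := by
      nth_rewrite 2 [hQ]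
      rw [mul_sub, mul_one, hQE, sub_zero]
    have hQZ : Q * Z = Z * Q := by rw [hQ, sub_mul, mul_sub, one_mul, mul_one, hZc]
    have hQZ' : Q * Zᴴ = Zᴴ * Q := by rw [hQ, sub_mul, mul_sub, one_mul, mul_one, hZc']
    rw [← hQ] at hM hzq ⊢
    obtain ⟨M, hMd⟩ : ∃ M, M = E i + Q * L * Q := ⟨_, rfl⟩
    rw [← hMd] at hM hzq
    have hEM : E i * M = E i := by
      rw [hMd, mul_add, h.mul_self, ← mul_assoc, ← mul_assoc, hEQ]; simp
    have hME : M * E i = E i := by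
      rw [hMd, add_mul, h.mul_self, mul_assoc, mul_assoc, hQE]; simp
    have hQM : Q * M = Q * L * Q := by
      rw [hMd, mul_add, hQE, zero_add, ← mul_assoc, ← mul_assoc, hQQ]
    obtain ⟨R, hR⟩ : ∃ R, R = ∑ j, z i j * (z i j)ᴴ := ⟨_, rfl⟩
    have hEGQ : E i * G * Q = E i * R * Q := by
      have e1 : E i * Δ * Q = 0 := by rw [hΔc, mul_assoc, hEQ, mul_zero]
      have e2 : ∀ a b, E i * (β a b * (β a b)ᴴ) * Q = 0 := by
        intro a b
        rcases eq_or_ne i a with rfl | hia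
        · have : (β i b)ᴴ * Q = 0 := by
            rw [← hβ, conjTranspose_mul, h.conjTranspose, Matrix.mul_assoc, hEQ, Matrix.mul_zero]
          rw [Matrix.mul_assoc, Matrix.mul_assoc, this, Matrix.mul_zero, Matrix.mul_zero]
        · rw [← Matrix.mul_assoc, hEne i a b hia]; simp
      have e3 : ∀ a, a ≠ i → ∀ b, E i * (β a b * (β b a)ᴴ) * Q = 0 := by
        intro a hia b
        rw [← Matrix.mul_assoc, hEne i a b hia.symm]; simp
      have e4 : ∀ b, E i * (β i b * (β b i)ᴴ) * Q = E i * (z i b * (z i b)ᴴ) * Q := by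
        intro b
        have := hzz i b
        rw [← hQ] at this
        rw [this, ← Matrix.mul_assoc, hβ, Matrix.mul_assoc]
        congr 1
        rcases eq_or_ne i b with rfl | hib
        · rw [hβ0]; simp
        · rw [hQ, Matrix.mul_sub, Matrix.mul_one]
          rw [show (β b i)ᴴ * E i = 0 by
            rw [← h.conjTranspose i, ← conjTranspose_mul, hEne i b i hib, conjTranspose_zero]]
          simp
      rw [hG, hR]
      simp only [mul_add, add_mul, Finset.mul_sum, Finset.sum_mul, e1, e2, Finset.sum_const_zero,
        zero_add]
      rw [Finset.sum_eq_single i]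
      · exact Finset.sum_congr rfl fun b _ => e4 b
      · intro a _ ha
        exact Finset.sum_eq_zero fun b _ => e3 a ha b
      · simp
    have hH : (Z * M * Zᴴ).PosDef := by
      refine hM.mul_mul_conjTranspose_same ?_
      exact vecMul_injective_of_isUnit hZu
    have hRp : (Z * R * Zᴴ).PosSemidef := by
      rw [hR]
      exact (posSemidef_sum _ fun j _ => posSemidef_self_mul_conjTranspose _).mul_mul_conjTranspose_same _
    have hkk : E i * (Z * L) * E i * (Z * L)ᴴ * Q = E i * (Z * L * Zᴴ) * Q := by
      calc E i * (Z * L) * E i * (Z * L)ᴴ * Q = (E i * Z) * L * E i * L * Zᴴ * Q := by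
            rw [conjTranspose_mul, hLs]; simp only [mul_assoc]
        _ = Z * (E i * L * E i) * L * Zᴴ * Q := by rw [hZc]; simp only [mul_assoc]
        _ = (Z * E i) * L * Zᴴ * Q := by rw [hEL]
        _ = _ := by rw [← hZc]; simp only [mul_assoc]
    have hcomm : E i * (Z * M * Zᴴ) = (Z * M * Zᴴ) * E i := by
      calc E i * (Z * M * Zᴴ) = (E i * Z) * M * Zᴴ := by simp only [mul_assoc]
        _ = Z * (E i * M) * Zᴴ := by rw [hZc]; simp only [mul_assoc]
        _ = Z * (M * E i) * Zᴴ := by rw [hEM, hME]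
        _ = Z * M * (E i * Zᴴ) := by simp only [mul_assoc]
        _ = _ := by rw [hZc']; simp only [mul_assoc]
    have hlyap : (Z * M * Zᴴ) * (E i * (Z * L * Zᴴ) * Q) + (E i * (Z * L * Zᴴ) * Q) * (Z * M * Zᴴ)
        = E i * (Z * R * Zᴴ) * (1 - E i) := by
      have t1 : (Z * M * Zᴴ) * (E i * (Z * L * Zᴴ) * Q)
          = Z * (E i * L * (Zᴴ * Z) * (E i * L * Q)) * Zᴴ := by
        calc _ = Z * M * (Zᴴ * E i) * Z * L * (Zᴴ * Q) := by simp only [mul_assoc]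
          _ = Z * (M * E i) * Zᴴ * Z * L * Q * Zᴴ := by
              rw [← hZc', ← hQZ']; simp only [mul_assoc]
          _ = Z * (E i * L * E i) * Zᴴ * Z * L * Q * Zᴴ := by rw [hME, hEL]
          _ = Z * (E i * L * (E i * (Zᴴ * Z)) * L * Q) * Zᴴ := by simp only [mul_assoc]
          _ = _ := by rw [hBc]; simp only [mul_assoc]
      have t2 : (E i * (Z * L * Zᴴ) * Q) * (Z * M * Zᴴ)
          = Z * (E i * L * (Zᴴ * Z) * (Q * L * Q)) * Zᴴ := by
        calc _ = (E i * Z) * L * Zᴴ * (Q * Z) * M * Zᴴ := by simp only [mul_assoc]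
          _ = Z * (E i * L * (Zᴴ * Z) * (Q * M)) * Zᴴ := by
              rw [hZc, hQZ]; simp only [mul_assoc]
          _ = _ := by rw [hQM]
      have t3 : E i * (Z * R * Zᴴ) * (1 - E i) = Z * (E i * G * Q) * Zᴴ := by
        calc E i * (Z * R * Zᴴ) * (1 - E i) = (E i * Z) * R * (Zᴴ * Q) := by
              rw [hQ]; simp only [mul_assoc]
          _ = Z * (E i * R * Q) * Zᴴ := by rw [hZc, ← hQZ']; simp only [mul_assoc]
          _ = _ := by rw [hEGQ]
      -- The middle factors `E` and `Q` from the two terms sum to `1` and rebuild `L (Z†Z) L = G`.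
      rw [t1, t2, t3, ← add_mul, ← mul_add, ← mul_add, ← add_mul, ← add_mul, hQ,
        add_sub_cancel, one_mul, hGL]
      simp only [mul_assoc]
    have hfin := traceNorm_lyapunov_block_le hH hRp (h.projection i) hcomm hlyap
    have hdetM := (isUnit_iff_isUnit_det M).1 hM.isUnit
    have htr : ((Z * M * Zᴴ)⁻¹ * (Z * R * Zᴴ)).trace.re = ∑ j, quad M⁻¹ (z i j) := by
      have : (Z * M * Zᴴ)⁻¹ * (Z * R * Zᴴ) = (Zᴴ)⁻¹ * (M⁻¹ * R * Zᴴ) := by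
        rw [Matrix.mul_inv_rev, Matrix.mul_inv_rev]
        calc _ = (Zᴴ)⁻¹ * (M⁻¹ * (Z⁻¹ * Z) * R * Zᴴ) := by simp only [mul_assoc]
          _ = _ := by rw [nonsing_inv_mul _ hdetZ, mul_one]
      rw [this, trace_mul_comm, mul_assoc, mul_nonsing_inv _ hdetZh, mul_one, hR, Finset.mul_sum,
        trace_sum, Complex.re_sum]
      simp only [quad_eq]
    rw [hkk]
    refine hfin.trans ?_
    rw [htr]
    have := Finset.sum_le_sum fun j (_ : j ∈ Finset.univ) => hzq j
    linarith
  have hksum := Finset.sum_le_sum fun i (_ : i ∈ Finset.univ) => hk i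
  rw [← Finset.sum_div] at hksum
  simp only [Finset.sum_add_distrib] at hksum
  rw [← hν, hquad] at hksum
  rw [hquad] at hlow
  rw [Finset.sum_add_distrib, hεsum, ← hν]
  -- Put `x = Re tr (L⁻¹ Δ)`. The leakage is `tr Δ + ν - τ ≤ x + ν - τ`, the coherences are at most
  -- `ν/4 + (τ - x)/2`, and `ν ≤ 2(τ - x)`; the sum is at most `ν`.
  linarith

end BlockEstimate

/-! ### Nearly optimal projective measurements -/

section Measurement

variable {κ n : Type*} [Fintype κ] [Fintype n] [DecidableEq n]

/-- An isometry onto the positive part of a Hermitian matrix. -/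
lemma exists_positive_part {X : Matrix n n ℂ} (hX : X.IsHermitian) :
    ∃ (s : Finset n) (J : Matrix n s ℂ) (w : s → ℝ), (∀ a, 0 < w a) ∧ Jᴴ * J = 1 ∧
      Jᴴ * X * J = diagonal (fun a => (w a : ℂ)) ∧ X.trace.re ≤ (Jᴴ * X * J).trace.re := by
  obtain ⟨U, v, h1, h2, h3⟩ := exists_diagonalization hX
  have h4 := diag_mul_mul_eq_of_unitary h1 h3
  -- Only strictly positive eigenvalues are kept, so the compression is positive definite; dropping
  -- the others cannot lower the trace.
  set s : Finset n := Finset.univ.filter fun a => 0 < v a with hs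
  have hJ : ∀ D : Matrix n n ℂ, (U.submatrix id (Subtype.val : s → n))ᴴ * D *
      U.submatrix id (Subtype.val : s → n)
        = (Uᴴ * D * U).submatrix (Subtype.val : s → n) (Subtype.val : s → n) := by
    intro D
    ext a b
    simp [Matrix.mul_apply]
  have hw : (U.submatrix id (Subtype.val : s → n))ᴴ * X * U.submatrix id (Subtype.val : s → n)
      = diagonal (fun a : s => (v a : ℂ)) := by
    rw [hJ, h4, submatrix_diagonal _ _ Subtype.val_injective]
    rfl
  refine ⟨s, U.submatrix id Subtype.val, fun a => v a, fun a => (Finset.mem_filter.1 a.2).2, ?_,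
    hw, ?_⟩
  · have := hJ 1
    rw [Matrix.mul_one, Matrix.mul_one, h1] at this
    rw [this, submatrix_one _ Subtype.val_injective]
  · have e : X.trace = ∑ a, (v a : ℂ) := by
      rw [h3, trace_mul_cycle, h1, one_mul, trace_diagonal]
    rw [hw, trace_diagonal, e, Complex.re_sum, Complex.re_sum, Finset.sum_coe_sort s
      (fun a => ((v a : ℂ)).re)]
    simp only [Complex.ofReal_re]
    rw [hs, Finset.sum_filter]
    refine Finset.sum_le_sum fun a _ => ?_
    split_ifs with h
    · exact le_rfl
    · exact not_lt.1 h

/-- A symmetric family of balanced factorizations of the products of square roots. -/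
lemma exists_factorization_family [LinearOrder κ] (A : κ → Matrix n n ℂ) :
    ∃ B : κ → κ → Matrix n n ℂ, (∀ i, B i i = 0) ∧
      (∀ i j, i ≠ j → CFC.sqrt (A i) * CFC.sqrt (A j) = B i j * (B j i)ᴴ) ∧
      ∀ i j, i ≠ j → hsSq (B i j) = traceNorm (CFC.sqrt (A i) * CFC.sqrt (A j)) := by
  have hs : ∀ i, (CFC.sqrt (A i))ᴴ = CFC.sqrt (A i) := fun i =>
    (CFC.sqrt_nonneg (A i)).posSemidef.isHermitian
  have hM : ∀ i j, (CFC.sqrt (A i) * CFC.sqrt (A j))ᴴ = CFC.sqrt (A j) * CFC.sqrt (A i) := by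
    intro i j
    rw [conjTranspose_mul, hs, hs]
  choose C D hCD hC hD using fun i j =>
    exists_factorization (CFC.sqrt (A i) * CFC.sqrt (A j))
  -- The order selects one factorization per unordered pair; the reversed pair uses its adjoint.
  refine ⟨fun i j => if i = j then 0 else if i < j then C i j else D j i, by simp, ?_, ?_⟩
  · intro i j hij
    rcases lt_or_gt_of_ne hij with h | h
    · simp [hij, hij.symm, h, h.not_gt, hCD i j]
    · simp only [hij, hij.symm, h, h.not_gt, if_true, if_false]
      rw [← hM, hCD j i, conjTranspose_mul, conjTranspose_conjTranspose]
  · intro i j hij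
    rcases lt_or_gt_of_ne hij with h | h
    · simp [hij, h, hC]
    · simp [hij, h.not_gt, hD]
      rw [← hM, traceNorm_conjTranspose]

/-! ### Block projectors of a direct sum -/

section Inclusion

variable [DecidableEq κ] {s : κ → Type*} [∀ i, Fintype (s i)] [∀ i, DecidableEq (s i)]

/-- The inclusion of a summand into a direct sum. -/
def inclusion (s : κ → Type*) [∀ i, DecidableEq (s i)] (i : κ) : Matrix (Σ i, s i) (s i) ℂ :=
  Matrix.of fun p y => if p = ⟨i, y⟩ then 1 else 0

lemma inclusion_conjTranspose_mul_self (i : κ) : (inclusion s i)ᴴ * inclusion s i = 1 := by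
  ext a b
  simp [inclusion, Matrix.mul_apply, Matrix.one_apply, eq_comm]

lemma inclusion_conjTranspose_mul_of_ne {i j : κ} (h : i ≠ j) :
    (inclusion s i)ᴴ * inclusion s j = 0 := by
  ext a b
  simp only [inclusion, Matrix.mul_apply, conjTranspose_apply, Matrix.of_apply, Matrix.zero_apply]
  refine Finset.sum_eq_zero fun p _ => ?_
  by_cases hp : p = ⟨i, a⟩
  · have : p ≠ ⟨j, b⟩ := by
      rintro rfl
      exact h (congrArg Sigma.fst hp).symm
    simp [this]
  · simp [hp]

lemma sum_inclusion_mul_diagonal (f : ∀ i, s i → ℂ) :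
    ∑ i, inclusion s i * diagonal (f i) * (inclusion s i)ᴴ
      = diagonal (fun p : Σ i, s i => f p.1 p.2) := by
  ext p q
  have e : ∀ i, (inclusion s i * diagonal (f i) * (inclusion s i)ᴴ) p q
      = ∑ y, (if p = ⟨i, y⟩ then 1 else 0) * f i y *
        star (if q = ⟨i, y⟩ then (1 : ℂ) else 0) := by
    intro i
    rw [Matrix.mul_apply]
    simp only [mul_diagonal, conjTranspose_apply, inclusion, Matrix.of_apply]
  simp only [Matrix.sum_apply, e]
  rw [← Fintype.sum_sigma (f := fun r : Σ i, s i => (if p = r then 1 else 0) * f r.1 r.2 *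
    star (if q = r then (1 : ℂ) else 0))]
  rw [Finset.sum_eq_single p]
  · by_cases h : p = q
    · subst h; simp
    · simp [h, Ne.symm h]
  · intro r _ hr
    simp [Ne.symm hr]
  · simp

lemma isPVM_inclusion : IsPVM fun i => inclusion s i * (inclusion s i)ᴴ where
  projection i := by
    constructor
    · rw [IsIdempotentElem, Matrix.mul_assoc, ← Matrix.mul_assoc _ (inclusion s i),
        inclusion_conjTranspose_mul_self, Matrix.one_mul]
    · rw [IsSelfAdjoint, star_eq_conjTranspose, conjTranspose_mul, conjTranspose_conjTranspose]
  orthogonal i j h := by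
    rw [Matrix.mul_assoc, ← Matrix.mul_assoc _ (inclusion s j),
      inclusion_conjTranspose_mul_of_ne h]
    simp
  complete := by
    have := sum_inclusion_mul_diagonal (s := s) (fun _ _ => 1)
    simpa using this

end Inclusion

lemma trace_proj_mul {P : Matrix n n ℂ} (hP : IsStarProjection P) (X : Matrix n n ℂ) :
    (P * X * P).trace = (P * X).trace := by
  rw [trace_mul_cycle, hP.isIdempotentElem.eq]

lemma PosSemidef.proj_mul_mul {P X : Matrix n n ℂ} (hX : X.PosSemidef) (hP : IsStarProjection P) :
    (P * X * P).PosSemidef := by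
  have h := hX.mul_mul_conjTranspose_same P
  rwa [show Pᴴ = P from hP.isSelfAdjoint] at h

/-- The disturbance by a projective measurement is at most twice the trace. -/
lemma traceNorm_sub_proj_add_le {D P : Matrix n n ℂ} (hD : D.PosSemidef)
    (hP : IsStarProjection P) :
    traceNorm (D - P * D * P) + ((1 - P) * D).trace.re ≤ 2 * D.trace.re := by
  have hp := PosSemidef.proj_mul_mul hD hP
  have h1 := traceNorm_sub_le D (P * D * P)
  rw [traceNorm_of_posSemidef hD, traceNorm_of_posSemidef hp, trace_proj_mul hP] at h1
  rw [sub_mul, one_mul, trace_sub, Complex.sub_re]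
  linarith

lemma traceNorm_sub_block_le {E Y : Matrix n n ℂ} (hE : IsStarProjection E) :
    traceNorm (Y * E * Yᴴ - E * (Y * E * Yᴴ) * E) + ((1 - E) * (Y * E * Yᴴ)).trace.re
      ≤ 2 * (hsSq ((1 - E) * Y * E) + traceNorm (E * Y * E * Yᴴ * (1 - E))) := by
  have h1 : Eᴴ = E := hE.isSelfAdjoint
  have h2 : E * E = E := hE.isIdempotentElem
  have hQ : IsStarProjection (1 - E) := hE.one_sub
  have hQ1 : (1 - E)ᴴ = 1 - E := hQ.isSelfAdjoint
  obtain ⟨W, hW⟩ : ∃ W, W = Y * E * Yᴴ := ⟨_, rfl⟩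
  have hWh : Wᴴ = W := by rw [hW]; simp [h1, mul_assoc]
  have hWp : W.PosSemidef := by
    have : W = (Y * E) * (Y * E)ᴴ := by
      rw [hW, conjTranspose_mul, h1, mul_assoc, mul_assoc, ← mul_assoc E, h2]
    rw [this]; exact posSemidef_self_mul_conjTranspose _
  have e1 : hsSq ((1 - E) * Y * E) = ((1 - E) * W).trace.re := by
    rw [hsSq, ← trace_proj_mul hQ, hW, conjTranspose_mul, conjTranspose_mul, h1, hQ1]
    congr 2
    calc _ = (1 - E) * Y * (E * E) * Yᴴ * (1 - E) := by simp only [mul_assoc]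
      _ = _ := by rw [h2]; simp only [mul_assoc]
  have e2 : E * Y * E * Yᴴ * (1 - E) = E * W * (1 - E) := by rw [hW]; simp only [mul_assoc]
  rw [← hW, e1, e2]
  have e3 : W - E * W * E = E * W * (1 - E) + (E * W * (1 - E))ᴴ + (1 - E) * W * (1 - E) := by
    rw [conjTranspose_mul, conjTranspose_mul, hQ1, h1, hWh]
    noncomm_ring
  have h3 : traceNorm (W - E * W * E) ≤ 2 * traceNorm (E * W * (1 - E)) + ((1 - E) * W).trace.re := by
    rw [e3]
    refine (traceNorm_add_le _ _).trans ?_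
    have h4 := traceNorm_add_le (E * W * (1 - E)) (E * W * (1 - E))ᴴ
    rw [traceNorm_conjTranspose] at h4
    rw [traceNorm_of_posSemidef (PosSemidef.proj_mul_mul hWp hQ), trace_proj_mul hQ]
    linarith
  linarith

/-- A projective measurement that discriminates a family of positive semidefinite matrices with
little disturbance, provided that the matrices are nearly orthogonal. -/
theorem exists_pvm_le [LinearOrder κ] [Nonempty κ] {A : κ → Matrix n n ℂ}
    (hA : ∀ i, (A i).PosSemidef) :
    ∃ P : κ → Matrix n n ℂ, IsPVM P ∧
      ∑ i, (traceNorm (A i - P i * A i * P i) + ((1 - P i) * A i).trace.re)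
        ≤ 2 * ∑ i, ∑ j ∈ Finset.univ.erase i, traceNorm (CFC.sqrt (A i) * CFC.sqrt (A j)) := by
  obtain ⟨B, hB0, hB, hBn⟩ := exists_factorization_family A
  obtain ⟨N, hN⟩ : ∃ N : κ → Matrix n n ℂ, ∀ i, N i = ∑ j, B i j * (B i j)ᴴ := ⟨_, fun _ => rfl⟩
  have hNp : ∀ i, (N i).PosSemidef := fun i => by
    rw [hN]; exact posSemidef_sum _ fun j _ => posSemidef_self_mul_conjTranspose _
  choose s J w hw hJ hJX hJt using fun i =>
    exists_positive_part ((hA i).isHermitian.sub (hNp i).isHermitian)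
  set V := fun i => inclusion (fun i => (s i : Type _)) i with hV
  have hVV : ∀ i, (V i)ᴴ * V i = 1 := fun i => inclusion_conjTranspose_mul_self i
  have hVne : ∀ i j, i ≠ j → (V i)ᴴ * V j = 0 := fun i j h => inclusion_conjTranspose_mul_of_ne h
  obtain ⟨E, hEdef⟩ : ∃ E, E = fun i => V i * (V i)ᴴ := ⟨_, rfl⟩
  have hE : IsPVM E := by rw [hEdef]; exact isPVM_inclusion
  have hEi : ∀ i, E i = V i * (V i)ᴴ := fun i => by rw [hEdef]
  have hEV : ∀ i, E i * V i = V i := fun i => by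
    rw [hEi, Matrix.mul_assoc, hVV, Matrix.mul_one]
  obtain ⟨R, hR⟩ : ∃ R : κ → Matrix n n ℂ, ∀ i, R i = CFC.sqrt (A i) := ⟨_, fun _ => rfl⟩
  have hRh : ∀ i, (R i)ᴴ = R i := fun i => by
    rw [hR]; exact (CFC.sqrt_nonneg (A i)).posSemidef.isHermitian
  have hRR : ∀ i, R i * R i = A i := fun i => by
    rw [hR]; exact CFC.sqrt_mul_sqrt_self (A i) (hA i).nonneg
  -- `T` acts as `√(A i)` on the `i`-th retained subspace, so the off-diagonal blocks of `T†T` are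
  -- compressed products of square roots.
  obtain ⟨T, hT⟩ : ∃ T, T = ∑ i, R i * J i * (V i)ᴴ := ⟨_, rfl⟩
  have hTV : ∀ i, T * V i = R i * J i := by
    intro i
    rw [hT, Matrix.sum_mul, Finset.sum_eq_single i]
    · rw [Matrix.mul_assoc, hVV, Matrix.mul_one]
    · intro j _ hj
      rw [Matrix.mul_assoc, hVne j i hj, Matrix.mul_zero]
    · simp
  obtain ⟨Δ, hΔ⟩ : ∃ Δ, Δ = ∑ i, V i * ((J i)ᴴ * (A i - N i) * J i) * (V i)ᴴ := ⟨_, rfl⟩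
  have hΔp : Δ.PosDef := by
    have : Δ = diagonal (fun p : Σ i, s i => ((w p.1 p.2 : ℝ) : ℂ)) := by
      rw [hΔ, ← sum_inclusion_mul_diagonal (s := fun i => (s i : Type _))
        (fun i a => ((w i a : ℝ) : ℂ))]
      refine Finset.sum_congr rfl fun i _ => ?_
      rw [hJX]
    rw [this]
    refine PosDef.diagonal fun p => ?_
    exact_mod_cast hw p.1 p.2
  have hΔc : ∀ i, E i * Δ = Δ * E i := by
    have e : ∀ i, E i * Δ = V i * ((J i)ᴴ * (A i - N i) * J i) * (V i)ᴴ := by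
      intro i
      rw [hΔ, Matrix.mul_sum, Finset.sum_eq_single i]
      · rw [← Matrix.mul_assoc, ← Matrix.mul_assoc, hEV]
      · intro j _ hj
        rw [hEi, ← Matrix.mul_assoc, ← Matrix.mul_assoc, Matrix.mul_assoc (V i), hVne i j hj.symm]
        simp
      · simp
    intro i
    rw [e]
    have h1 := congrArg Matrix.conjTranspose (e i)
    rw [conjTranspose_mul, hE.conjTranspose, hΔp.isHermitian.eq] at h1
    rw [h1]
    simp only [conjTranspose_mul, conjTranspose_conjTranspose, conjTranspose_sub,
      (hA i).isHermitian.eq, (hNp i).isHermitian.eq, Matrix.mul_assoc]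
  obtain ⟨β, hβ⟩ : ∃ β : κ → κ → Matrix (Σ i, s i) n ℂ,
    ∀ i j, β i j = V i * (J i)ᴴ * B i j := ⟨_, fun _ _ => rfl⟩
  have hβE : ∀ i j, E i * β i j = β i j := fun i j => by
    rw [hβ, ← Matrix.mul_assoc, ← Matrix.mul_assoc, hEV]
  have hG : Tᴴ * T = Δ + ∑ i, ∑ j, β i j * (β i j)ᴴ + ∑ i, ∑ j, β i j * (β j i)ᴴ := by
    have e1 : ∀ i j, β i j * (β j i)ᴴ = V i * ((J i)ᴴ * (B i j * (B j i)ᴴ) * J j) * (V j)ᴴ := by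
      intro i j
      rw [hβ, hβ]
      simp only [conjTranspose_mul, conjTranspose_conjTranspose, Matrix.mul_assoc]
    have e2 : ∀ i, ∑ j, β i j * (β i j)ᴴ = V i * ((J i)ᴴ * N i * J i) * (V i)ᴴ := by
      intro i
      rw [hN]
      simp only [Matrix.mul_sum, Matrix.sum_mul]
      refine Finset.sum_congr rfl fun j _ => ?_
      rw [hβ]
      simp only [conjTranspose_mul, conjTranspose_conjTranspose, Matrix.mul_assoc]
    have e3 : Δ + ∑ i, ∑ j, β i j * (β i j)ᴴ
        = ∑ i, V i * ((J i)ᴴ * (R i * R i) * J i) * (V i)ᴴ := by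
      rw [hΔ, ← Finset.sum_add_distrib]
      refine Finset.sum_congr rfl fun i _ => ?_
      rw [e2, ← Matrix.add_mul, ← Matrix.mul_add, ← Matrix.add_mul, ← Matrix.mul_add,
        sub_add_cancel, hRR]
    rw [e3, hT, conjTranspose_sum, Matrix.sum_mul, ← Finset.sum_add_distrib]
    refine Finset.sum_congr rfl fun i _ => ?_
    rw [Matrix.mul_sum, ← Finset.add_sum_erase _ _ (Finset.mem_univ i),
      ← Finset.add_sum_erase _ (fun j => β i j * (β j i)ᴴ) (Finset.mem_univ i)]
    rw [show β i i * (β i i)ᴴ = 0 by rw [hβ, hB0]; simp, zero_add]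
    congr 1
    · simp only [conjTranspose_mul, conjTranspose_conjTranspose, hRh, Matrix.mul_assoc]
    · refine Finset.sum_congr rfl fun j hj => ?_
      rw [e1, ← hB i j (Finset.ne_of_mem_erase hj).symm, ← hR, ← hR]
      simp only [conjTranspose_mul, conjTranspose_conjTranspose, hRh, Matrix.mul_assoc]
  obtain ⟨Y, hYu, hYY, hest⟩ := hE.exists_root_block_estimate hΔp hΔc β hβE
    (fun i => by rw [hβ, hB0]; simp) hG
  have hdet := (isUnit_iff_isUnit_det Y).1 hYu
  -- `T†T = Y†Y` makes `F` an isometry, and the images under `F` of the blocks are the orthogonal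
  -- ranges sought.
  obtain ⟨F, hF⟩ : ∃ F, F = T * Y⁻¹ := ⟨_, rfl⟩
  have hFY : F * Y = T := by rw [hF, Matrix.mul_assoc, nonsing_inv_mul _ hdet, Matrix.mul_one]
  have hFF : Fᴴ * F = 1 := by
    rw [hF, conjTranspose_mul, Matrix.mul_assoc, ← Matrix.mul_assoc Tᴴ, ← hYY, Matrix.mul_assoc,
      mul_nonsing_inv _ hdet, Matrix.mul_one, ← conjTranspose_mul, mul_nonsing_inv _ hdet,
      conjTranspose_one]
  obtain ⟨C, hC⟩ : ∃ C, C = 1 - F * Fᴴ := ⟨_, rfl⟩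
  have hCF : C * F = 0 := by
    rw [hC, Matrix.sub_mul, Matrix.mul_assoc, hFF, Matrix.one_mul, Matrix.mul_one, sub_self]
  have hCh : Cᴴ = C := by
    rw [hC, conjTranspose_sub, conjTranspose_mul, conjTranspose_conjTranspose, conjTranspose_one]
  have hFC : Fᴴ * C = 0 := by
    rw [← hCh, ← conjTranspose_mul, hCF, conjTranspose_zero]
  have hCC : C * C = C := by
    nth_rewrite 2 [hC]
    rw [Matrix.mul_sub, Matrix.mul_one, ← Matrix.mul_assoc, hCF, Matrix.zero_mul, sub_zero]
  obtain ⟨i₀⟩ := ‹Nonempty κ›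
  -- The complement `C` of the range of `F` goes to an arbitrary outcome `i₀`; it is invisible on
  -- that range.
  obtain ⟨P, hP⟩ : ∃ P : κ → Matrix n n ℂ,
    ∀ i, P i = F * E i * Fᴴ + if i = i₀ then C else 0 := ⟨_, fun _ => rfl⟩
  have hmulF : ∀ X X' : Matrix (Σ i, s i) (Σ i, s i) ℂ,
      F * X * Fᴴ * (F * X' * Fᴴ) = F * (X * X') * Fᴴ := by
    intro X X'
    calc _ = F * X * (Fᴴ * F) * X' * Fᴴ := by simp only [Matrix.mul_assoc]
      _ = _ := by rw [hFF]; simp only [Matrix.mul_assoc, Matrix.one_mul]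
  have hCX : ∀ X : Matrix (Σ i, s i) (Σ i, s i) ℂ, C * (F * X * Fᴴ) = 0 := by
    intro X
    rw [← Matrix.mul_assoc, ← Matrix.mul_assoc, hCF]; simp
  have hXC : ∀ X : Matrix (Σ i, s i) (Σ i, s i) ℂ, F * X * Fᴴ * C = 0 := by
    intro X
    rw [Matrix.mul_assoc, hFC]; simp
  have hPvm : IsPVM P := by
    constructor
    · intro i
      constructor
      · rw [IsIdempotentElem, hP]
        split_ifs
        · rw [mul_add, add_mul, add_mul, hmulF, hE.mul_self, hCX, hXC, hCC, add_zero, zero_add]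
        · rw [add_zero, hmulF, hE.mul_self]
      · rw [IsSelfAdjoint, star_eq_conjTranspose, hP]
        split_ifs <;> simp [hE.conjTranspose, hCh, Matrix.mul_assoc]
    · intro i j hij
      rw [hP, hP]
      by_cases h1 : i = i₀
      · have h2 : j ≠ i₀ := fun h => hij (h1.trans h.symm)
        rw [if_pos h1, if_neg h2, add_zero, add_mul, hmulF, hE.orthogonal i j hij, hCX]; simp
      · rw [if_neg h1, add_zero, mul_add, hmulF, hE.orthogonal i j hij]
        split_ifs <;> simp [hXC]
    · simp only [hP, Finset.sum_add_distrib, Finset.sum_ite_eq', Finset.mem_univ, if_true]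
      rw [← Matrix.sum_mul, ← Matrix.mul_sum, hE.complete, Matrix.mul_one, hC, add_sub_cancel]
  have hPF : ∀ i, P i * F = F * E i := by
    intro i
    rw [hP, Matrix.add_mul, Matrix.mul_assoc, hFF, Matrix.mul_one]
    split_ifs <;> simp [hCF]
  refine ⟨P, hPvm, ?_⟩
  -- `D i` is the part of `A i` lost by restricting to the positive part of `A i - N i`.
  obtain ⟨D, hD⟩ : ∃ D : κ → Matrix n n ℂ, ∀ i, D i = R i * (1 - J i * (J i)ᴴ) * R i :=
    ⟨_, fun _ => rfl⟩
  have hDp : ∀ i, (D i).PosSemidef := by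
    intro i
    have h1 : (1 - J i * (J i)ᴴ)ᴴ * (1 - J i * (J i)ᴴ) = 1 - J i * (J i)ᴴ := by
      have : J i * (J i)ᴴ * (J i * (J i)ᴴ) = J i * (J i)ᴴ := by
        rw [Matrix.mul_assoc, ← Matrix.mul_assoc _ (J i), hJ, Matrix.one_mul]
      simp [mul_sub, sub_mul, this]
    have h2 := (posSemidef_conjTranspose_mul_self (1 - J i * (J i)ᴴ)).mul_mul_conjTranspose_same
      (R i)
    rwa [h1, hRh, ← hD] at h2
  have hAd : ∀ i, A i = T * E i * Tᴴ + D i := by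
    intro i
    have h1 : T * E i * Tᴴ = R i * (J i * (J i)ᴴ) * R i := by
      calc T * E i * Tᴴ = (T * V i) * (T * V i)ᴴ := by
            rw [hEi, conjTranspose_mul]; simp only [Matrix.mul_assoc]
        _ = _ := by
            rw [hTV, conjTranspose_mul, hRh]; simp only [Matrix.mul_assoc]
    rw [h1, hD, ← add_mul, ← mul_add, add_sub_cancel, mul_one, hRR]
  have htrD : ∀ i, (D i).trace.re ≤ (N i).trace.re - ((J i)ᴴ * N i * J i).trace.re := by
    intro i
    have h1 : (D i).trace = (A i).trace - ((J i)ᴴ * A i * J i).trace := by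
      rw [hD, mul_sub, sub_mul, mul_one, hRR, trace_sub, trace_mul_comm, ← mul_assoc, hRR,
        ← Matrix.mul_assoc, trace_mul_comm, ← Matrix.mul_assoc]
    have h2 := hJt i
    rw [Matrix.mul_sub, Matrix.sub_mul, trace_sub, trace_sub, Complex.sub_re, Complex.sub_re] at h2
    rw [h1, Complex.sub_re]
    linarith
  have hmain : ∀ i, traceNorm (A i - P i * A i * P i) + ((1 - P i) * A i).trace.re
      ≤ 2 * (hsSq ((1 - E i) * Y * E i) + traceNorm (E i * Y * E i * Yᴴ * (1 - E i)))
        + 2 * (D i).trace.re := by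
    intro i
    have h1 := traceNorm_sub_proj_add_le (hDp i) (hPvm.projection i)
    have h2 := traceNorm_sub_block_le (Y := Y) (hE.projection i)
    obtain ⟨W, hW⟩ : ∃ W, W = Y * E i * Yᴴ := ⟨_, rfl⟩
    rw [← hW] at h2
    have h3 : T * E i * Tᴴ = F * W * Fᴴ := by
      rw [← hFY, hW, conjTranspose_mul]; simp only [Matrix.mul_assoc]
    have hFP : Fᴴ * P i = E i * Fᴴ := by
      have := congrArg Matrix.conjTranspose (hPF i)
      rwa [conjTranspose_mul, conjTranspose_mul, hPvm.conjTranspose, hE.conjTranspose] at this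
    have h4 : P i * (F * W * Fᴴ) * P i = F * (E i * W * E i) * Fᴴ := by
      calc _ = (P i * F) * W * (Fᴴ * P i) := by simp only [Matrix.mul_assoc]
        _ = _ := by rw [hPF, hFP]; simp only [Matrix.mul_assoc]
    have h5 : A i - P i * A i * P i = F * (W - E i * W * E i) * Fᴴ + (D i - P i * D i * P i) := by
      rw [hAd i, h3, mul_add, add_mul, h4, Matrix.mul_sub, Matrix.sub_mul]
      abel
    have h6 : traceNorm (F * (W - E i * W * E i) * Fᴴ) ≤ traceNorm (W - E i * W * E i) :=
      traceNorm_mul_mul_le (isContraction_of_isometry hFF) (isContraction_of_isometry hFF) _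
    have h7 : ((1 - P i) * A i).trace.re = ((1 - E i) * W).trace.re + ((1 - P i) * D i).trace.re := by
      have h8 : (P i * (F * W * Fᴴ)).trace = (E i * W).trace := by
        rw [← Matrix.mul_assoc, ← Matrix.mul_assoc, hPF, trace_mul_comm, ← Matrix.mul_assoc,
          ← Matrix.mul_assoc, hFF, Matrix.one_mul]
      have h9 : (F * W * Fᴴ).trace = W.trace := by
        rw [trace_mul_comm, ← Matrix.mul_assoc, hFF, Matrix.one_mul]
      rw [hAd i, h3, mul_add, trace_add, Complex.add_re]
      congr 1
      rw [sub_mul, sub_mul, one_mul, one_mul, trace_sub, trace_sub, h8, h9]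
    have h10 := traceNorm_add_le (F * (W - E i * W * E i) * Fᴴ) (D i - P i * D i * P i)
    rw [h5, h7]
    linarith
  have hβn : ∀ i, ∑ j, hsSq (β i j) = ((J i)ᴴ * N i * J i).trace.re := by
    intro i
    rw [hN, Matrix.mul_sum, Matrix.sum_mul, trace_sum, Complex.re_sum]
    refine Finset.sum_congr rfl fun j _ => ?_
    rw [hsSq, hβ]
    have : V i * (J i)ᴴ * B i j * (V i * (J i)ᴴ * B i j)ᴴ
        = V i * ((J i)ᴴ * (B i j * (B i j)ᴴ) * J i * (V i)ᴴ) := by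
      simp only [conjTranspose_mul, conjTranspose_conjTranspose, Matrix.mul_assoc]
    rw [this, trace_mul_comm, Matrix.mul_assoc, hVV, Matrix.mul_one]
  have hNt : ∀ i, (N i).trace.re
      = ∑ j ∈ Finset.univ.erase i, traceNorm (CFC.sqrt (A i) * CFC.sqrt (A j)) := by
    intro i
    rw [hN, trace_sum, Complex.re_sum, ← Finset.add_sum_erase _ _ (Finset.mem_univ i), hB0]
    simp only [Matrix.zero_mul, trace_zero, Complex.zero_re, zero_add]
    exact Finset.sum_congr rfl fun j hj => hBn i j (Finset.ne_of_mem_erase hj).symm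
  have hsum := Finset.sum_le_sum fun i (_ : i ∈ Finset.univ) => hmain i
  have hsumD := Finset.sum_le_sum fun i (_ : i ∈ Finset.univ) => htrD i
  simp only [Finset.sum_add_distrib, ← Finset.mul_sum] at hsum hest ⊢
  rw [Finset.sum_sub_distrib] at hsumD
  simp only [hβn] at hest
  simp only [hNt] at hsumD
  -- Twice the compressed traces `tr (J†NJ)` bounds the block terms, twice `tr N - tr (J†NJ)` bounds
  -- the discarded parts; the compressed traces cancel.
  linarith

end Measurement

/-! ### Tensor products and the trace norm -/

section TraceNormMore

variable {α β : Type*} [Fintype α] [Fintype β] [DecidableEq α] [DecidableEq β]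

lemma traceNorm_smul (c : ℂ) (X : Matrix α α ℂ) : traceNorm (c • X) = ‖c‖ * traceNorm X := by
  refine le_antisymm (traceNorm_smul_le c X) ?_
  rcases eq_or_ne c 0 with rfl | hc
  · simp
  have h := traceNorm_smul_le c⁻¹ (c • X)
  rw [smul_smul, inv_mul_cancel₀ hc, one_smul, norm_inv] at h
  rwa [← le_inv_mul_iff₀ (norm_pos_iff.2 hc)]

lemma hsSq_kronecker (A : Matrix α α ℂ) (B : Matrix β β ℂ) :
    hsSq (A ⊗ₖ B) = hsSq A * hsSq B := by
  simp only [hsSq_eq_sum, Fintype.sum_prod_type, kroneckerMap_apply, norm_mul, mul_pow]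
  rw [Finset.sum_mul_sum]
  refine Finset.sum_congr rfl fun i _ => Finset.sum_congr rfl fun j _ => ?_
  rw [Finset.sum_mul_sum]

/-- Hilbert–Schmidt norms are multiplicative, so the tensor product of balanced factorizations is
balanced. -/
lemma traceNorm_kronecker_le (A : Matrix α α ℂ) (B : Matrix β β ℂ) :
    traceNorm (A ⊗ₖ B) ≤ traceNorm A * traceNorm B := by
  obtain ⟨A₁, A₂, hA, h1, h2⟩ := exists_factorization A
  obtain ⟨B₁, B₂, hB, h3, h4⟩ := exists_factorization B
  have e : A ⊗ₖ B = (A₁ ⊗ₖ B₁) * (A₂ ⊗ₖ B₂)ᴴ := by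
    rw [conjTranspose_kronecker, ← mul_kronecker_mul, ← hA, ← hB]
  rw [e]
  refine (traceNorm_mul_conjTranspose_le _ _).trans (le_of_eq ?_)
  rw [hsSq_kronecker, hsSq_kronecker, h1, h2, h3, h4]
  ring

lemma hsSq_single (i j : α) : hsSq (single i j (1 : ℂ)) = 1 := by
  rw [hsSq, conjTranspose_single, single_mul_single_same]
  simp

lemma traceNorm_single_le (i j : α) : traceNorm (single i j (1 : ℂ)) ≤ 1 := by
  have e : single i j (1 : ℂ) = single i i 1 * (single j i 1)ᴴ := by
    rw [conjTranspose_single, single_mul_single_same]; simp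
  rw [e]
  refine (traceNorm_mul_conjTranspose_le _ _).trans (le_of_eq ?_)
  rw [hsSq_single, hsSq_single]
  norm_num

lemma traceNorm_le_sum_norm (X : Matrix α α ℂ) : traceNorm X ≤ ∑ a, ∑ b, ‖X a b‖ := by
  conv_lhs => rw [matrix_eq_sum_single X]
  refine (traceNorm_sum_le _ _).trans (Finset.sum_le_sum fun a _ => ?_)
  refine (traceNorm_sum_le _ _).trans (Finset.sum_le_sum fun b _ => ?_)
  have e : single a b (X a b) = X a b • single a b (1 : ℂ) := by
    rw [smul_single, smul_eq_mul, mul_one]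
  rw [e, traceNorm_smul]
  exact mul_le_of_le_one_right (norm_nonneg _) (traceNorm_single_le a b)

/-- The triangle inequality bounds variations by the sum of entry norms, so no continuity of the
matrix square root is involved. -/
lemma continuous_traceNorm : Continuous (traceNorm : Matrix α α ℂ → ℝ) := by
  rw [continuous_iff_continuousAt]
  intro X₀
  rw [ContinuousAt, tendsto_iff_dist_tendsto_zero]
  have h : Filter.Tendsto (fun X : Matrix α α ℂ => ∑ a, ∑ b, ‖(X - X₀) a b‖) (nhds X₀) (nhds 0) := by
    have hc : Continuous fun X : Matrix α α ℂ => ∑ a, ∑ b, ‖(X - X₀) a b‖ := by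
      simp only [Matrix.sub_apply]
      fun_prop
    have := hc.tendsto X₀
    simpa using this
  refine squeeze_zero (fun _ => dist_nonneg) (fun X => ?_) h
  rw [Real.dist_eq, abs_le]
  have h1 := traceNorm_le_sum_norm (X - X₀)
  have h2 := traceNorm_add_le (X - X₀) X₀
  have h3 := traceNorm_sub_le X (X - X₀)
  rw [sub_add_cancel] at h2
  rw [sub_sub_cancel] at h3
  constructor <;> linarith

lemma re_trace_le_traceNorm (X : Matrix α α ℂ) : X.trace.re ≤ traceNorm X := by
  have h := re_trace_mul_le_traceNorm X (W := 1) (isContraction_of_isometry (by simp))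
  simpa using h

end TraceNormMore

/-! ### Finite tensor products and telescoping -/

section Tensor

variable {m : ℕ} {n : Fin m → ℕ}

lemma tensor_mul (X Y : ∀ k, Matrix (Fin (n k)) (Fin (n k)) ℂ) :
    tensor X * tensor Y = tensor fun k => X k * Y k := by
  ext x y
  simp only [tensor, Matrix.mul_apply, Matrix.of_apply, ← Finset.prod_mul_distrib]
  rw [Finset.prod_univ_sum, Fintype.piFinset_univ]

lemma tensor_conjTranspose (X : ∀ k, Matrix (Fin (n k)) (Fin (n k)) ℂ) :
    (tensor X)ᴴ = tensor fun k => (X k)ᴴ := by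
  ext x y
  simp [tensor]

lemma trace_tensor (X : ∀ k, Matrix (Fin (n k)) (Fin (n k)) ℂ) :
    (tensor X).trace = ∏ k, (X k).trace := by
  simp only [tensor, Matrix.trace, Matrix.diag_apply, Matrix.of_apply]
  rw [Finset.prod_univ_sum, Fintype.piFinset_univ]

lemma tensor_smul (c : Fin m → ℂ) (X : ∀ k, Matrix (Fin (n k)) (Fin (n k)) ℂ) :
    (tensor fun k => c k • X k) = (∏ k, c k) • tensor X := by
  ext x y
  simp [tensor, Finset.prod_mul_distrib]

lemma tensor_eq_zero {X : ∀ k, Matrix (Fin (n k)) (Fin (n k)) ℂ} (k : Fin m) (h : X k = 0) :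
    tensor X = 0 := by
  ext x y
  simp only [tensor, Matrix.of_apply, Matrix.zero_apply]
  exact Finset.prod_eq_zero (Finset.mem_univ k) (by rw [h]; simp)

lemma posSemidef_tensor {X : ∀ k, Matrix (Fin (n k)) (Fin (n k)) ℂ}
    (h : ∀ k, (X k).PosSemidef) : (tensor X).PosSemidef := by
  choose C hC using fun k => CStarAlgebra.nonneg_iff_eq_star_mul_self.mp (h k).nonneg
  have : tensor X = (tensor C)ᴴ * tensor C := by
    rw [tensor_conjTranspose, tensor_mul]
    congr 1
    ext1 k
    exact hC k
  rw [this]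
  exact posSemidef_conjTranspose_mul_self _

lemma hsSq_tensor (X : ∀ k, Matrix (Fin (n k)) (Fin (n k)) ℂ) :
    hsSq (tensor X) = ∏ k, hsSq (X k) := by
  simp only [hsSq_eq_sum, tensor, Matrix.of_apply, norm_prod, ← Finset.prod_pow]
  rw [Finset.prod_univ_sum, Fintype.piFinset_univ]
  refine Finset.sum_congr rfl fun x _ => ?_
  rw [Finset.prod_univ_sum, Fintype.piFinset_univ]

lemma traceNorm_tensor_le (X : ∀ k, Matrix (Fin (n k)) (Fin (n k)) ℂ) :
    traceNorm (tensor X) ≤ ∏ k, traceNorm (X k) := by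
  choose B C h hB hC using fun k => exists_factorization (X k)
  have e : tensor X = tensor B * (tensor C)ᴴ := by
    rw [tensor_conjTranspose, tensor_mul]
    congr 1
    ext1 k
    exact h k
  rw [e]
  refine (traceNorm_mul_conjTranspose_le _ _).trans (le_of_eq ?_)
  rw [hsSq_tensor, hsSq_tensor]
  simp only [hB, hC]
  ring

lemma tensor_update_sub (H : ∀ k, Matrix (Fin (n k)) (Fin (n k)) ℂ) (a : Fin m)
    (X Y : Matrix (Fin (n a)) (Fin (n a)) ℂ) :
    tensor (Function.update H a X) - tensor (Function.update H a Y)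
      = tensor (Function.update H a (X - Y)) := by
  have e : ∀ Z : Matrix (Fin (n a)) (Fin (n a)) ℂ, ∀ x y, tensor (Function.update H a Z) x y
      = Z (x a) (y a) * ∏ k ∈ Finset.univ.erase a, H k (x k) (y k) := by
    intro Z x y
    rw [tensor, Matrix.of_apply, ← Finset.mul_prod_erase _ _ (Finset.mem_univ a),
      Function.update_self]
    congr 1
    refine Finset.prod_congr rfl fun k hk => ?_
    rw [Function.update_of_ne (Finset.ne_of_mem_erase hk)]
  ext x y
  rw [Matrix.sub_apply, e, e, e, Matrix.sub_apply, sub_mul]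

/-- Telescoping estimate for the distance of two tensor products. -/
lemma traceNorm_tensor_sub_le {X Y : ∀ k, Matrix (Fin (n k)) (Fin (n k)) ℂ}
    (hX : ∀ k, traceNorm (X k) ≤ 1) (hY : ∀ k, traceNorm (Y k) ≤ 1) :
    traceNorm (tensor X - tensor Y) ≤ ∑ k, traceNorm (X k - Y k) := by
  have key : ∀ s : Finset (Fin m), ∀ H : ∀ k, Matrix (Fin (n k)) (Fin (n k)) ℂ,
      (∀ k ∈ s, H k = Y k) → (∀ k ∉ s, H k = X k) →
      traceNorm (tensor X - tensor H) ≤ ∑ k ∈ s, traceNorm (X k - Y k) := by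
    intro s
    induction s using Finset.induction_on with
    | empty =>
      intro H _ h2
      have : H = X := funext fun k => h2 k (by simp)
      simp [this]
    | insert a s ha ih =>
      intro H h1 h2
      have hH : H = Function.update H a (Y a) := by
        rw [← h1 a (Finset.mem_insert_self a s), Function.update_eq_self]
      have h3 := ih (Function.update H a (X a))
        (fun k hk => by
          rw [Function.update_of_ne (ne_of_mem_of_not_mem hk ha)]
          exact h1 k (Finset.mem_insert_of_mem hk))
        (fun k hk => by
          rcases eq_or_ne k a with rfl | hka
          · simp
          · rw [Function.update_of_ne hka]
            exact h2 k (by simp [hka, hk]))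
      have h4 : traceNorm (tensor (Function.update H a (X a - Y a))) ≤ traceNorm (X a - Y a) := by
        refine (traceNorm_tensor_le _).trans ?_
        rw [← Finset.mul_prod_erase _ _ (Finset.mem_univ a), Function.update_self]
        refine mul_le_of_le_one_right (traceNorm_nonneg _) ?_
        refine Finset.prod_le_one (fun k _ => traceNorm_nonneg _) fun k hk => ?_
        rw [Function.update_of_ne (Finset.ne_of_mem_erase hk)]
        by_cases hks : k ∈ insert a s
        · rw [h1 k hks]; exact hY k
        · rw [h2 k hks]; exact hX k
      rw [← tensor_update_sub, ← hH] at h4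
      have h5 := traceNorm_add_le (tensor X - tensor (Function.update H a (X a)))
        (tensor (Function.update H a (X a)) - tensor H)
      rw [sub_add_sub_cancel] at h5
      rw [Finset.sum_insert ha]
      linarith
  exact key Finset.univ Y (fun _ _ => rfl) (fun k hk => absurd (Finset.mem_univ k) hk)

lemma continuous_tensor {β : Type*} [TopologicalSpace β]
    {f : β → ∀ k, Matrix (Fin (n k)) (Fin (n k)) ℂ} (hf : ∀ k, Continuous fun b => f b k) :
    Continuous fun b => tensor (f b) := by
  refine continuous_matrix fun x y => ?_
  simp only [tensor, Matrix.of_apply]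
  exact continuous_finsetProd _ fun k _ => (hf k).matrix_elem _ _

end Tensor

/-! ### Partial trace -/

section PartialTrace

variable {α β γ : Type*} [Fintype α] [Fintype β] [Fintype γ]

lemma partialTrace_eq_sum (X : Matrix (α × β × γ) (α × β × γ) ℂ) :
    partialTrace X = ∑ z, X.submatrix (fun p : α × β => (p.1, p.2, z)) (fun p => (p.1, p.2, z)) := by
  ext p q
  simp [partialTrace, Matrix.sum_apply]

lemma posSemidef_partialTrace {X : Matrix (α × β × γ) (α × β × γ) ℂ} (hX : X.PosSemidef) :
    (partialTrace X).PosSemidef := by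
  rw [partialTrace_eq_sum]
  exact posSemidef_sum _ fun z _ => hX.submatrix _

lemma partialTrace_kronecker (A : Matrix α α ℂ) (B : Matrix β β ℂ) (C : Matrix γ γ ℂ) :
    partialTrace (A ⊗ₖ (B ⊗ₖ C)) = C.trace • (A ⊗ₖ B) := by
  ext p q
  simp only [partialTrace, Matrix.of_apply, kroneckerMap_apply, Matrix.smul_apply, smul_eq_mul,
    Matrix.trace, Matrix.diag_apply, Finset.sum_mul]
  exact Finset.sum_congr rfl fun z _ => by ring

lemma partialTrace_sum {κ : Type*} (s : Finset κ) (X : κ → Matrix (α × β × γ) (α × β × γ) ℂ) :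
    partialTrace (∑ i ∈ s, X i) = ∑ i ∈ s, partialTrace (X i) := by
  ext p q
  simp only [partialTrace, Matrix.of_apply, Matrix.sum_apply]
  exact Finset.sum_comm

end PartialTrace

/-! ### Unitarity of the local evolution -/

section Evolution

variable {ι : Type*} [Fintype ι] [DecidableEq ι]

lemma localU_unitary (a t : ℝ) {B : Matrix ι ι ℂ} (hB : B.IsHermitian) :
    (localU a t B)ᴴ * localU a t B = 1 := by
  have h : (localU a t B)ᴴ = (localU a t B)⁻¹ := by
    rw [localU, ← Matrix.exp_conjTranspose, ← Matrix.exp_neg]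
    congr 1
    rw [conjTranspose_smul, hB.eq, ← neg_smul]
    congr 1
    simp
  have hu : IsUnit (localU a t B) := by
    rw [localU]
    exact Matrix.isUnit_exp _
  rw [h, nonsing_inv_mul _ ((isUnit_iff_isUnit_det _).1 hu)]

end Evolution

lemma one_sub_prod_le_sum {κ : Type*} (s : Finset κ) {p : κ → ℝ} (h0 : ∀ k, 0 ≤ p k)
    (h1 : ∀ k, p k ≤ 1) : 1 - ∏ k ∈ s, p k ≤ ∑ k ∈ s, (1 - p k) := by
  classical
  induction s using Finset.induction_on with
  | empty => simp
  | insert a s ha ih =>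
    rw [Finset.prod_insert ha, Finset.sum_insert ha]
    have h2 : ∏ k ∈ s, p k ≤ 1 := Finset.prod_le_one (fun k _ => h0 k) fun k _ => h1 k
    nlinarith [h0 a, h1 a]

/-- Square roots scale with the square root of the factor. -/
lemma sqrt_smul_of_posSemidef {ι : Type*} [Fintype ι] [DecidableEq ι] {A : Matrix ι ι ℂ}
    (hA : A.PosSemidef) {c : ℝ} (hc : 0 ≤ c) :
    CFC.sqrt ((c : ℂ) • A) = ((√c : ℝ) : ℂ) • CFC.sqrt A := by
  refine CFC.sqrt_unique ?_ ?_
  · rw [smul_mul_smul_comm, CFC.sqrt_mul_sqrt_self A hA.nonneg, ← Complex.ofReal_mul,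
      Real.mul_self_sqrt hc]
  · refine Matrix.PosSemidef.nonneg ?_
    refine ((CFC.sqrt_nonneg A).posSemidef).smul ?_
    exact_mod_cast Real.sqrt_nonneg c

/-! ### The model -/

namespace Model

variable {d m l : ℕ} {n : Fin m → ℕ} {n' : Fin l → ℕ} (S : Model d m l n n') (t : ℝ)

lemma UE_unitary (i : Fin d) (k : Fin m) : (S.UE t i k)ᴴ * S.UE t i k = 1 :=
  localU_unitary _ _ (S.BE_hermitian k)

lemma UD_unitary (i : Fin d) (k : Fin l) : (S.UD t i k)ᴴ * S.UD t i k = 1 :=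
  localU_unitary _ _ (S.BD_hermitian k)

lemma isDensity_conj {ι : Type*} [Fintype ι] [DecidableEq ι] {ρ V : Matrix ι ι ℂ}
    (hρ : IsDensity ρ) (hV : Vᴴ * V = 1) : IsDensity (V * ρ * Vᴴ) := by
  refine ⟨hρ.posSemidef.mul_mul_conjTranspose_same V, ?_⟩
  rw [trace_mul_cycle, hV, one_mul, hρ.trace_eq_one]

lemma isDensity_condState (i : Fin d) (k : Fin m) : IsDensity (S.condState t i k) :=
  isDensity_conj (S.ρE_density k) (S.UE_unitary t i k)

lemma traceNorm_density {ι : Type*} [Fintype ι] [DecidableEq ι] {ρ : Matrix ι ι ℂ}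
    (h : IsDensity ρ) : traceNorm ρ = 1 := by
  rw [traceNorm_of_posSemidef h.posSemidef, h.trace_eq_one, Complex.one_re]

lemma traceNorm_ρE'_le (i j : Fin d) (k : Fin m) : traceNorm (S.ρE' t i j k) ≤ 1 := by
  have h := traceNorm_mul_mul_le (isContraction_of_isometry (S.UE_unitary t i k))
    (isContraction_of_isometry (S.UE_unitary t j k)) (S.ρE k)
  rwa [traceNorm_density (S.ρE_density k)] at h

lemma γ_self (i : Fin d) (k : Fin l) : S.γ t i i k = 1 :=
  (isDensity_conj (S.ρD_density k) (S.UD_unitary t i k)).trace_eq_one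

lemma ρS_diag (i : Fin d) : S.ρS i i = (S.σ i : ℂ) := by
  have h := S.ρS_density.posSemidef.diag_nonneg (i := i)
  exact (Complex.ext rfl (by simpa using (Complex.nonneg_iff.1 h).2.symm))

lemma σ_nonneg (i : Fin d) : 0 ≤ S.σ i :=
  (Complex.nonneg_iff.1 (S.ρS_density.posSemidef.diag_nonneg (i := i))).1

lemma sum_σ : ∑ i, S.σ i = 1 := by
  have h := congrArg Complex.re S.ρS_density.trace_eq_one
  simpa [Matrix.trace, Complex.re_sum, σ] using h

/-- The evolution is block diagonal in the pointer basis, so tracing out the discarded parts leaves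
the decoherence factors as scalars. -/
lemma reducedState_eq : S.reducedState t = ∑ i, ∑ j, (S.ρS i j * ∏ k, S.γ t i j k) •
    (single i j (1 : ℂ) ⊗ₖ tensor fun k => S.ρE' t i j k) := by
  have hU : (S.U t)ᴴ = ∑ j, pointer j ⊗ₖ
      ((tensor (S.UE t j))ᴴ ⊗ₖ (tensor (S.UD t j))ᴴ) := by
    rw [U, conjTranspose_sum]
    refine Finset.sum_congr rfl fun j _ => ?_
    rw [conjTranspose_kronecker, conjTranspose_kronecker, pointer, conjTranspose_single, star_one]
  rw [reducedState, hU, U, initialState, Finset.sum_mul, Finset.sum_mul, partialTrace_sum]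
  refine Finset.sum_congr rfl fun i _ => ?_
  rw [Finset.mul_sum, partialTrace_sum]
  refine Finset.sum_congr rfl fun j _ => ?_
  rw [← mul_kronecker_mul, ← mul_kronecker_mul, ← mul_kronecker_mul, ← mul_kronecker_mul,
    tensor_mul, tensor_mul, tensor_conjTranspose, tensor_conjTranspose, tensor_mul, tensor_mul,
    partialTrace_kronecker, trace_tensor]
  have e : pointer i * S.ρS * pointer j = S.ρS i j • single i j (1 : ℂ) := by
    rw [pointer, pointer, single_mul_mul_single, smul_single]
    simp
  rw [e, smul_kronecker, smul_smul, mul_comm]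
  rfl

/-- The part of the state that is diagonal in the pointer basis. -/
def diagState : Matrix (Fin d × (∀ k, Fin (n k))) (Fin d × (∀ k, Fin (n k))) ℂ :=
  ∑ i, (S.σ i : ℂ) • (pointer i ⊗ₖ tensor fun k => S.condState t i k)

/-- The diagonal terms cancel because `γ_ii = 1`; each remaining operator has trace norm at most
`1`. -/
lemma traceNorm_reducedState_sub_diagState_le :
    traceNorm (S.reducedState t - S.diagState t) ≤ S.Γ t := by
  have e : S.reducedState t - S.diagState t = ∑ i, ∑ j ∈ Finset.univ.erase i,
      (S.ρS i j * ∏ k, S.γ t i j k) • (single i j (1 : ℂ) ⊗ₖ tensor fun k => S.ρE' t i j k) := by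
    rw [reducedState_eq, diagState, ← Finset.sum_sub_distrib]
    refine Finset.sum_congr rfl fun i _ => ?_
    rw [← Finset.add_sum_erase _ _ (Finset.mem_univ i)]
    simp only [γ_self, Finset.prod_const_one, mul_one, ρS_diag]
    exact add_sub_cancel_left _ _
  rw [e, Γ]
  refine (traceNorm_sum_le _ _).trans (Finset.sum_le_sum fun i _ => ?_)
  refine (traceNorm_sum_le _ _).trans (Finset.sum_le_sum fun j _ => ?_)
  rw [traceNorm_smul, norm_mul, norm_prod]
  refine mul_le_of_le_one_right (by positivity) ((traceNorm_kronecker_le _ _).trans ?_)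
  refine mul_le_one₀ (traceNorm_single_le i j) (traceNorm_nonneg _) ?_
  refine (traceNorm_tensor_le _).trans ?_
  exact Finset.prod_le_one (fun k _ => traceNorm_nonneg _) fun k _ => S.traceNorm_ρE'_le t i j k

lemma Γ_nonneg : 0 ≤ S.Γ t := (traceNorm_nonneg _).trans (S.traceNorm_reducedState_sub_diagState_le t)

lemma isDensity_reducedState : IsDensity (S.reducedState t) := by
  constructor
  · refine posSemidef_partialTrace (PosSemidef.mul_mul_conjTranspose_same ?_ _)
    exact S.ρS_density.posSemidef.kronecker
      ((posSemidef_tensor fun k => (S.ρE_density k).posSemidef).kronecker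
        (posSemidef_tensor fun k => (S.ρD_density k).posSemidef))
  · rw [reducedState_eq]
    simp only [trace_sum, trace_smul, trace_kronecker, trace_tensor]
    have e : ∀ i j : Fin d, (S.ρS i j * ∏ k, S.γ t i j k) •
        ((single i j (1 : ℂ)).trace * ∏ k, (S.ρE' t i j k).trace)
        = if i = j then S.ρS i i else 0 := by
      intro i j
      split_ifs with h
      · subst h
        have h1 : ∀ k, (S.ρE' t i i k).trace = 1 := fun k =>
          (S.isDensity_condState t i k).trace_eq_one
        simp [h1, γ_self]
      · simp [trace_single_eq_of_ne, h]
    simp only [e, Finset.sum_ite_eq, Finset.mem_univ, if_true]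
    exact S.ρS_density.trace_eq_one

/-! ### Measured states and two-sided control of the SBS distance -/

section Measured

variable {P : ∀ k : Fin m, Fin d → Matrix (Fin (n k)) (Fin (n k)) ℂ}

lemma posSemidef_projState (hP : IsMeasurement P) (i : Fin d) (k : Fin m) :
    (S.projState P t i k).PosSemidef :=
  PosSemidef.proj_mul_mul (S.isDensity_condState t i k).posSemidef (hP.projection k i)

lemma trace_projState (hP : IsMeasurement P) (i : Fin d) (k : Fin m) :
    (S.projState P t i k).trace = (S.prob P t i k : ℂ) := by
  have h := (S.posSemidef_projState t hP i k).trace_nonneg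
  exact Complex.ext rfl (by simpa using (Complex.nonneg_iff.1 h).2.symm)

lemma prob_nonneg (hP : IsMeasurement P) (i : Fin d) (k : Fin m) : 0 ≤ S.prob P t i k :=
  PosSemidef_trace_re_nonneg (S.posSemidef_projState t hP i k)

lemma one_sub_prob (hP : IsMeasurement P) (i : Fin d) (k : Fin m) :
    1 - S.prob P t i k = ((1 - P k i) * S.condState t i k).trace.re := by
  rw [prob, projState, trace_proj_mul (hP.projection k i), sub_mul, one_mul, trace_sub,
    (S.isDensity_condState t i k).trace_eq_one]
  simp

lemma prob_le_one (hP : IsMeasurement P) (i : Fin d) (k : Fin m) : S.prob P t i k ≤ 1 := by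
  have h1 := PosSemidef_trace_re_nonneg (PosSemidef.proj_mul_mul
    (S.isDensity_condState t i k).posSemidef (hP.projection k i).one_sub)
  rw [trace_proj_mul (hP.projection k i).one_sub, ← S.one_sub_prob t hP] at h1
  linarith

lemma jointProb_nonneg (hP : IsMeasurement P) (i : Fin d) : 0 ≤ S.jointProb P t i :=
  Finset.prod_nonneg fun k _ => S.prob_nonneg t hP i k

lemma jointProb_le_one (hP : IsMeasurement P) (i : Fin d) : S.jointProb P t i ≤ 1 :=
  Finset.prod_le_one (fun k _ => S.prob_nonneg t hP i k) fun k _ => S.prob_le_one t hP i k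

lemma totalProb_le_one (hP : IsMeasurement P) : S.totalProb P t ≤ 1 := by
  rw [← S.sum_σ, totalProb]
  exact Finset.sum_le_sum fun i _ => mul_le_of_le_one_right (S.σ_nonneg i)
    (S.jointProb_le_one t hP i)

lemma trace_tensor_projState (hP : IsMeasurement P) (i : Fin d) :
    (tensor fun k => S.projState P t i k).trace = (S.jointProb P t i : ℂ) := by
  rw [trace_tensor, jointProb, Complex.ofReal_prod]
  exact Finset.prod_congr rfl fun k _ => S.trace_projState t hP i k

lemma posSemidef_pointer (i : Fin d) : (pointer i).PosSemidef := by
  have h := posSemidef_self_mul_conjTranspose (single i i (1 : ℂ))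
  rw [conjTranspose_single, single_mul_single_same] at h
  simpa [pointer] using h

lemma trace_pointer (i : Fin d) : (pointer i).trace = 1 := by
  rw [pointer, trace_single_eq_same]

/-- The SBS state without the normalizations of the projected states. -/
lemma sbsState_eq (hP : IsMeasurement P) :
    S.sbsState P t = ∑ i, ((S.σ i / S.totalProb P t : ℝ) : ℂ) •
      (pointer i ⊗ₖ tensor fun k => S.projState P t i k) := by
  rw [sbsState]
  refine Finset.sum_congr rfl fun i _ => ?_
  rw [tensor_smul, kronecker_smul, smul_smul]
  -- A zero probability makes the positive semidefinite projected state vanish; otherwise the local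
  -- normalizations cancel `jointProb`.
  by_cases h : ∃ k, S.prob P t i k = 0
  · obtain ⟨k, hk⟩ := h
    have h1 : S.projState P t i k = 0 := by
      refine (S.posSemidef_projState t hP i k).trace_eq_zero_iff.1 ?_
      rw [S.trace_projState t hP, hk, Complex.ofReal_zero]
    rw [tensor_eq_zero k h1]
    simp
  · push Not at h
    congr 1
    rw [Finset.prod_inv_distrib, ← Complex.ofReal_prod, ← jointProb, ← Complex.ofReal_inv,
      ← Complex.ofReal_mul]
    congr 1
    have : S.jointProb P t i ≠ 0 := Finset.prod_ne_zero_iff.2 fun k _ => h k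
    field_simp

lemma isDensity_sbsState (hP : IsMeasurement P) (h : 0 < S.totalProb P t) :
    IsDensity (S.sbsState P t) := by
  rw [S.sbsState_eq t hP]
  constructor
  · refine posSemidef_sum _ fun i _ => PosSemidef.smul ?_ ?_
    · exact (posSemidef_pointer i).kronecker
        (posSemidef_tensor fun k => S.posSemidef_projState t hP i k)
    · have := div_nonneg (S.σ_nonneg i) h.le
      exact_mod_cast this
  · simp only [trace_sum, trace_smul, trace_kronecker, S.trace_tensor_projState t hP, trace_pointer,
      one_mul, smul_eq_mul, ← Complex.ofReal_mul, ← Complex.ofReal_sum]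
    have : ∑ i, S.σ i / S.totalProb P t * S.jointProb P t i = 1 := by
      have e : ∀ i, S.σ i / S.totalProb P t * S.jointProb P t i
          = S.σ i * S.jointProb P t i / S.totalProb P t := fun i => by ring
      simp only [e]
      rw [← Finset.sum_div]
      exact div_self h.ne'
    rw [this, Complex.ofReal_one]

lemma sbsDistance_le_one (hP : IsMeasurement P) (h : 0 < S.totalProb P t) :
    S.sbsDistance P t ≤ 1 := by
  have h1 := traceNorm_sub_le (S.reducedState t) (S.sbsState P t)
  rw [traceNorm_density (S.isDensity_reducedState t),
    traceNorm_density (S.isDensity_sbsState t hP h)] at h1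
  rw [sbsDistance]
  linarith

lemma traceNorm_projState_le (hP : IsMeasurement P) (i : Fin d) (k : Fin m) :
    traceNorm (S.projState P t i k) ≤ 1 := by
  rw [traceNorm_of_posSemidef (S.posSemidef_projState t hP i k)]
  exact S.prob_le_one t hP i k

/-- The weighted local disturbances and local failure probabilities. -/
def localCost (P : ∀ k : Fin m, Fin d → Matrix (Fin (n k)) (Fin (n k)) ℂ) : ℝ :=
  ∑ i, S.σ i * ∑ k, (traceNorm (S.condState t i k - S.projState P t i k)
    + (1 - S.prob P t i k))

lemma one_sub_totalProb_le (hP : IsMeasurement P) :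
    1 - S.totalProb P t ≤ ∑ i, S.σ i * ∑ k, (1 - S.prob P t i k) := by
  have e : 1 - S.totalProb P t = ∑ i, S.σ i * (1 - S.jointProb P t i) := by
    simp only [mul_sub, mul_one, Finset.sum_sub_distrib, S.sum_σ, totalProb]
  rw [e]
  refine Finset.sum_le_sum fun i _ => ?_
  exact mul_le_mul_of_nonneg_left
    (one_sub_prod_le_sum _ (S.prob_nonneg t hP i) (S.prob_le_one t hP i)) (S.σ_nonneg i)

/-- The failure `1 - p` is the trace of `ρ - PρP`, hence also bounded by the disturbance; the local
cost counts it twice. -/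
lemma two_mul_one_sub_totalProb_le (hP : IsMeasurement P) :
    2 * (1 - S.totalProb P t) ≤ S.localCost t P := by
  have h := S.one_sub_totalProb_le t hP
  have h2 : 2 * ∑ i, S.σ i * ∑ k, (1 - S.prob P t i k) ≤ S.localCost t P := by
    rw [localCost, Finset.mul_sum]
    refine Finset.sum_le_sum fun i _ => ?_
    rw [mul_left_comm, Finset.mul_sum]
    refine mul_le_mul_of_nonneg_left (Finset.sum_le_sum fun k _ => ?_) (S.σ_nonneg i)
    have h3 := re_trace_le_traceNorm (S.condState t i k - S.projState P t i k)
    rw [trace_sub, Complex.sub_re, (S.isDensity_condState t i k).trace_eq_one, Complex.one_re] at h3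
    change 1 - S.prob P t i k ≤ _ at h3
    linarith
  linarith

/-- The distance of the state to an SBS state in terms of the decoherence and the local costs. -/
lemma sbsDistance_le (hP : IsMeasurement P) (h : 0 < S.totalProb P t) :
    S.sbsDistance P t ≤ (S.Γ t + S.localCost t P) / 2 := by
  obtain ⟨X, hX⟩ : ∃ X : Fin d → Matrix (Fin d × (∀ k, Fin (n k))) (Fin d × (∀ k, Fin (n k))) ℂ,
    ∀ i, X i = pointer i ⊗ₖ tensor fun k => S.projState P t i k := ⟨_, fun _ => rfl⟩
  have hXn : ∀ i, traceNorm (X i) = S.jointProb P t i := by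
    intro i
    have h1 : (X i).PosSemidef := by
      rw [hX]
      exact (posSemidef_pointer i).kronecker
        (posSemidef_tensor fun k => S.posSemidef_projState t hP i k)
    rw [traceNorm_of_posSemidef h1, hX, trace_kronecker, trace_pointer,
      S.trace_tensor_projState t hP, one_mul, Complex.ofReal_re]
  have h1 : traceNorm (S.diagState t - ∑ i, (S.σ i : ℂ) • X i)
      ≤ ∑ i, S.σ i * ∑ k, traceNorm (S.condState t i k - S.projState P t i k) := by
    rw [diagState, ← Finset.sum_sub_distrib]
    refine (traceNorm_sum_le _ _).trans (Finset.sum_le_sum fun i _ => ?_)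
    have e : (S.σ i : ℂ) • (pointer i ⊗ₖ tensor fun k => S.condState t i k) - (S.σ i : ℂ) • X i
        = (S.σ i : ℂ) • (pointer i ⊗ₖ ((tensor fun k => S.condState t i k)
          - tensor fun k => S.projState P t i k)) := by
      rw [hX, ← smul_sub]
      congr 1
      ext p q
      simp [mul_sub]
    rw [e, traceNorm_smul, Complex.norm_real, Real.norm_of_nonneg (S.σ_nonneg i)]
    refine mul_le_mul_of_nonneg_left ?_ (S.σ_nonneg i)
    refine (traceNorm_kronecker_le _ _).trans ?_
    refine (mul_le_of_le_one_left (traceNorm_nonneg _) (traceNorm_single_le i i)).trans ?_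
    exact traceNorm_tensor_sub_le
      (fun k => (traceNorm_density (S.isDensity_condState t i k)).le)
      (fun k => S.traceNorm_projState_le t hP i k)
  -- The SBS state is the unnormalized one divided by its trace, so the difference is a scalar
  -- multiple.
  have h2 : traceNorm ((∑ i, (S.σ i : ℂ) • X i) - S.sbsState P t) ≤ 1 - S.totalProb P t := by
    have e : (∑ i, (S.σ i : ℂ) • X i) - S.sbsState P t
        = ((1 - (S.totalProb P t)⁻¹ : ℝ) : ℂ) • ∑ i, (S.σ i : ℂ) • X i := by
      rw [S.sbsState_eq t hP, ← Finset.sum_sub_distrib, Finset.smul_sum]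
      refine Finset.sum_congr rfl fun i _ => ?_
      rw [← hX, ← sub_smul, smul_smul]
      congr 1
      push_cast
      ring
    have h3 : traceNorm (∑ i, (S.σ i : ℂ) • X i) ≤ S.totalProb P t := by
      refine (traceNorm_sum_le _ _).trans (Finset.sum_le_sum fun i _ => ?_)
      rw [traceNorm_smul, Complex.norm_real, Real.norm_of_nonneg (S.σ_nonneg i), hXn]
    have h4 : 1 ≤ (S.totalProb P t)⁻¹ := (one_le_inv₀ h).2 (S.totalProb_le_one t hP)
    rw [e, traceNorm_smul, Complex.norm_real, Real.norm_of_nonpos (by linarith)]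
    refine (mul_le_mul_of_nonneg_left h3 (by linarith)).trans (le_of_eq ?_)
    field_simp
    ring
  have h3 := S.traceNorm_reducedState_sub_diagState_le t
  have h4 := traceNorm_add_le (S.reducedState t - S.diagState t)
    (S.diagState t - S.sbsState P t)
  have h5 := traceNorm_add_le (S.diagState t - ∑ i, (S.σ i : ℂ) • X i)
    ((∑ i, (S.σ i : ℂ) • X i) - S.sbsState P t)
  rw [sub_add_sub_cancel] at h4 h5
  have h6 := S.one_sub_totalProb_le t hP
  have h7 : S.localCost t P = ∑ i, S.σ i * ∑ k, traceNorm (S.condState t i k - S.projState P t i k)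
      + ∑ i, S.σ i * ∑ k, (1 - S.prob P t i k) := by
    simp only [localCost, Finset.sum_add_distrib, mul_add]
  rw [sbsDistance, h7]
  linarith

/-- The projector onto the support of an SBS state. -/
def supportProj (P : ∀ k : Fin m, Fin d → Matrix (Fin (n k)) (Fin (n k)) ℂ) :
    Matrix (Fin d × (∀ k, Fin (n k))) (Fin d × (∀ k, Fin (n k))) ℂ :=
  ∑ i, pointer i ⊗ₖ tensor fun k => P k i

lemma isStarProjection_supportProj (hP : IsMeasurement P) :
    IsStarProjection (supportProj P) := by
  constructor
  · rw [IsIdempotentElem, supportProj, Finset.sum_mul]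
    refine Finset.sum_congr rfl fun i _ => ?_
    rw [Finset.mul_sum, Finset.sum_eq_single i]
    · rw [← mul_kronecker_mul, tensor_mul, pointer, single_mul_single_same, mul_one]
      congr 2
      ext1 k
      exact (hP.projection k i).isIdempotentElem
    · intro j _ hj
      rw [← mul_kronecker_mul, pointer, pointer, single_mul_single_of_ne _ _ _ _ hj.symm]
      simp
    · simp
  · rw [IsSelfAdjoint, star_eq_conjTranspose, supportProj, conjTranspose_sum]
    refine Finset.sum_congr rfl fun i _ => ?_
    rw [conjTranspose_kronecker, tensor_conjTranspose, pointer, conjTranspose_single, star_one]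
    congr 2
    ext1 k
    exact (hP.projection k i).isSelfAdjoint

lemma trace_supportProj_mul_reducedState (hP : IsMeasurement P) :
    (supportProj P * S.reducedState t).trace = (S.totalProb P t : ℂ) := by
  have e : ∀ r i j : Fin d, (pointer r * single i j (1 : ℂ)).trace
      = if r = i then if i = j then 1 else 0 else 0 := by
    intro r i j
    rw [pointer]
    by_cases h1 : r = i
    · subst h1
      rw [single_mul_single_same, mul_one, if_pos rfl]
      split_ifs with h2
      · subst h2; rw [trace_single_eq_same]
      · rw [trace_single_eq_of_ne _ _ _ h2]
    · rw [single_mul_single_of_ne _ _ _ _ h1, if_neg h1, trace_zero]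
  rw [supportProj, reducedState_eq, Finset.sum_mul, trace_sum, totalProb, Complex.ofReal_sum]
  refine Finset.sum_congr rfl fun r _ => ?_
  simp only [Finset.mul_sum, trace_sum, Matrix.mul_smul, trace_smul, ← mul_kronecker_mul,
    trace_kronecker, e, tensor_mul, trace_tensor]
  rw [Finset.sum_eq_single r (fun i _ hi => by simp [hi.symm]) (by simp),
    Finset.sum_eq_single r (fun j _ hj => by simp [hj.symm]) (by simp)]
  simp only [if_true, one_mul, γ_self, Finset.prod_const_one, mul_one, ρS_diag, smul_eq_mul,
    Complex.ofReal_mul, jointProb, Complex.ofReal_prod]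
  congr 1
  refine Finset.prod_congr rfl fun k _ => ?_
  rw [← S.trace_projState t hP, projState, trace_proj_mul (hP.projection k r)]
  rfl

lemma supportProj_mul_sbsState (hP : IsMeasurement P) :
    supportProj P * S.sbsState P t = S.sbsState P t := by
  rw [S.sbsState_eq t hP, Finset.mul_sum]
  refine Finset.sum_congr rfl fun i _ => ?_
  rw [Matrix.mul_smul]
  congr 1
  rw [supportProj, Finset.sum_mul, Finset.sum_eq_single i]
  · rw [← mul_kronecker_mul, tensor_mul, pointer, single_mul_single_same, mul_one]
    congr 2
    ext1 k
    rw [projState, ← mul_assoc, ← mul_assoc, (hP.projection k i).isIdempotentElem.eq]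
  · intro j _ hj
    rw [← mul_kronecker_mul, pointer, pointer, single_mul_single_of_ne _ _ _ _ hj]
    simp
  · simp

/-- The failure probability bounds the distance to the SBS state from below. -/
lemma one_sub_totalProb_le_sbsDistance (hP : IsMeasurement P) (h : 0 < S.totalProb P t) :
    1 - S.totalProb P t ≤ S.sbsDistance P t := by
  have hproj := isStarProjection_supportProj hP
  have h1 : (supportProj P)ᴴ = supportProj P := hproj.isSelfAdjoint
  have h2 : supportProj P * supportProj P = supportProj P := hproj.isIdempotentElem
  -- The reflection in the support is the dual test: it gives `-1` on the SBS state and `1 - 2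
  -- totalProb` on the actual state.
  have hW : (1 - (2 : ℂ) • supportProj P)ᴴ = 1 - (2 : ℂ) • supportProj P := by
    rw [conjTranspose_sub, conjTranspose_one, conjTranspose_smul, h1]
    simp
  have hWW : (1 - (2 : ℂ) • supportProj P)ᴴ * (1 - (2 : ℂ) • supportProj P) = 1 := by
    rw [hW, sub_mul, one_mul, mul_sub, mul_one, smul_mul_smul_comm, h2, mul_smul, two_smul ℂ
      ((2 : ℂ) • supportProj P)]
    abel
  have h3 := re_trace_mul_le_traceNorm (S.reducedState t - S.sbsState P t)
    (isContraction_of_isometry hWW)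
  have e : ((S.reducedState t - S.sbsState P t) * (1 - (2 : ℂ) • supportProj P)ᴴ).trace
      = ((2 - 2 * S.totalProb P t : ℝ) : ℂ) := by
    rw [hW, trace_mul_comm, sub_mul, one_mul, smul_mul_assoc, mul_sub,
      S.supportProj_mul_sbsState t hP]
    simp only [trace_sub, trace_smul, S.trace_supportProj_mul_reducedState t hP,
      (S.isDensity_reducedState t).trace_eq_one, (S.isDensity_sbsState t hP h).trace_eq_one,
      smul_eq_mul]
    push_cast
    ring
  rw [e, Complex.ofReal_re] at h3
  rw [sbsDistance]
  linarith

end Measured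

end Model

namespace Model

variable {d m l : ℕ} {n : Fin m → ℕ} {n' : Fin l → ℕ} (S : Model d m l n n') (t : ℝ)

/-! ### A measurement with small local cost -/

lemma exists_σ_pos : ∃ i, 0 < S.σ i := by
  by_contra! h
  have : ∑ i, S.σ i ≤ 0 := Finset.sum_nonpos fun i _ => h i
  rw [S.sum_σ] at this
  linarith

/-- The environments decouple: `exists_pvm_le` is used for each with `A i = σ_i ρ_i`, and the
weights leave the square roots as `√(σ_i σ_j)`. -/
lemma exists_localCost_le :
    ∃ P : ∀ k : Fin m, Fin d → Matrix (Fin (n k)) (Fin (n k)) ℂ, IsMeasurement P ∧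
      S.localCost t P ≤ 2 * (S.η t - S.Γ t) := by
  obtain ⟨i₀, -⟩ := S.exists_σ_pos
  have : Nonempty (Fin d) := ⟨i₀⟩
  have hA : ∀ k i, ((S.σ i : ℂ) • S.condState t i k).PosSemidef := fun k i =>
    (S.isDensity_condState t i k).posSemidef.smul (by exact_mod_cast S.σ_nonneg i)
  choose P hP hc using fun k => exists_pvm_le (hA k)
  have hPm : IsMeasurement P :=
    ⟨fun k => (hP k).projection, fun k => (hP k).orthogonal, fun k => (hP k).complete⟩
  refine ⟨P, hPm, ?_⟩
  have h1 : S.localCost t P = ∑ k, ∑ i,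
      (traceNorm ((S.σ i : ℂ) • S.condState t i k - P k i * ((S.σ i : ℂ) • S.condState t i k) * P k i)
        + ((1 - P k i) * ((S.σ i : ℂ) • S.condState t i k)).trace.re) := by
    rw [localCost, Finset.sum_comm]
    refine Finset.sum_congr rfl fun i _ => ?_
    rw [Finset.mul_sum]
    refine Finset.sum_congr rfl fun k _ => ?_
    rw [S.one_sub_prob t hPm, Matrix.mul_smul, smul_mul_assoc, ← smul_sub, traceNorm_smul,
      Complex.norm_real, Real.norm_of_nonneg (S.σ_nonneg i), Matrix.mul_smul, trace_smul,
      smul_eq_mul, Complex.re_ofReal_mul, mul_add]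
    rfl
  have h2 : ∀ k i j, traceNorm (CFC.sqrt ((S.σ i : ℂ) • S.condState t i k) *
      CFC.sqrt ((S.σ j : ℂ) • S.condState t j k))
        = √(S.σ i * S.σ j) * fidelity (S.condState t i k) (S.condState t j k) := by
    intro k i j
    rw [sqrt_smul_of_posSemidef (S.isDensity_condState t i k).posSemidef (S.σ_nonneg i),
      sqrt_smul_of_posSemidef (S.isDensity_condState t j k).posSemidef (S.σ_nonneg j),
      smul_mul_smul_comm, traceNorm_smul, ← Complex.ofReal_mul, ← Real.sqrt_mul (S.σ_nonneg i),
      Complex.norm_real, Real.norm_of_nonneg (Real.sqrt_nonneg _), fidelity]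
  have h3 : S.η t - S.Γ t = ∑ k, ∑ i, ∑ j ∈ Finset.univ.erase i,
      √(S.σ i * S.σ j) * fidelity (S.condState t i k) (S.condState t j k) := by
    rw [η, add_sub_cancel_left, Finset.sum_comm]
    refine Finset.sum_congr rfl fun i _ => ?_
    rw [Finset.sum_comm]
    refine Finset.sum_congr rfl fun j _ => ?_
    rw [Finset.mul_sum]
  rw [h1, h3, Finset.mul_sum]
  refine Finset.sum_le_sum fun k _ => ?_
  have h4 := hc k
  simp only [h2] at h4
  exact h4

/-- Unless the bound is trivial, some SBS state satisfies it. -/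
lemma exists_sbsDistance_le (h : S.η t < 1) :
    ∃ P : ∀ k : Fin m, Fin d → Matrix (Fin (n k)) (Fin (n k)) ℂ, IsMeasurement P ∧
      0 < S.totalProb P t ∧ S.sbsDistance P t ≤ S.η t := by
  obtain ⟨P, hP, hc⟩ := S.exists_localCost_le t
  have h0 := S.Γ_nonneg t
  have h1 := S.two_mul_one_sub_totalProb_le t hP
  -- The local cost is below `2` because `η < 1`, so the success probability is positive.
  have h2 : 0 < S.totalProb P t := by linarith
  refine ⟨P, hP, h2, (S.sbsDistance_le t hP h2).trans ?_⟩
  linarith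

lemma exists_measurement : ∃ P : ∀ k : Fin m, Fin d → Matrix (Fin (n k)) (Fin (n k)) ℂ,
    IsMeasurement P ∧ 0 < S.totalProb P t := by
  obtain ⟨i₀, hi₀⟩ := S.exists_σ_pos
  -- The trivial measurement that always announces an outcome `i₀` of positive weight.
  have hP : IsMeasurement (n := n) fun _ i => if i = i₀ then 1 else 0 := by
    refine ⟨fun k i => ?_, fun k i j hij => ?_, fun k => by simp⟩
    · split_ifs
      · exact IsStarProjection.one _
      · exact IsStarProjection.zero _
    · by_cases h : i = i₀
      · rw [if_neg (fun h' => hij (h.trans h'.symm) : ¬ j = i₀), mul_zero]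
      · rw [if_neg h, zero_mul]
  refine ⟨_, hP, ?_⟩
  rw [totalProb]
  refine Finset.sum_pos' (fun i _ => mul_nonneg (S.σ_nonneg i) (S.jointProb_nonneg t hP i))
    ⟨i₀, Finset.mem_univ _, mul_pos hi₀ ?_⟩
  refine Finset.prod_pos fun k _ => ?_
  simp [prob, projState, (S.isDensity_condState t i₀ k).trace_eq_one]

/-! ### Attainment -/

lemma isCompact_isStarProjection {ι : Type*} [Fintype ι] [DecidableEq ι] :
    IsCompact {p : Matrix ι ι ℂ | IsStarProjection p} := by
  have hset : {p : Matrix ι ι ℂ | IsStarProjection p} = {p | p * p = p} ∩ {p | pᴴ = p} := by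
    ext p
    exact ⟨fun h => ⟨h.isIdempotentElem, h.isSelfAdjoint⟩, fun h => ⟨h.1, h.2⟩⟩
  refine isCompact_of_norm_le ?_ (√(Fintype.card ι)) fun p hp i j => ?_
  · rw [hset]
    exact (isClosed_eq (by fun_prop) continuous_id).inter (isClosed_eq (by fun_prop) continuous_id)
  · refine Real.le_sqrt_of_sq_le ((norm_entry_sq_le_hsSq p i j).trans ?_)
    have h := hsSq_mul_le (isContraction_of_proj hp) (1 : Matrix ι ι ℂ)
    rw [mul_one] at h
    refine h.trans (le_of_eq ?_)
    simp [hsSq]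

lemma isCompact_isMeasurement :
    IsCompact {P : ∀ k : Fin m, Fin d → Matrix (Fin (n k)) (Fin (n k)) ℂ | IsMeasurement P} := by
  have hK : IsCompact (Set.pi Set.univ fun k : Fin m => Set.pi Set.univ fun _ : Fin d =>
      {p : Matrix (Fin (n k)) (Fin (n k)) ℂ | IsStarProjection p}) :=
    isCompact_univ_pi fun k => isCompact_univ_pi fun _ => isCompact_isStarProjection
  have hset : {P : ∀ k : Fin m, Fin d → Matrix (Fin (n k)) (Fin (n k)) ℂ | IsMeasurement P}
      = (Set.pi Set.univ fun k : Fin m => Set.pi Set.univ fun _ : Fin d =>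
          {p : Matrix (Fin (n k)) (Fin (n k)) ℂ | IsStarProjection p})
        ∩ ({P | ∀ k i j, i ≠ j → P k i * P k j = 0} ∩ {P | ∀ k, ∑ i, P k i = 1}) := by
    ext P
    exact ⟨fun h => ⟨fun k _ i _ => h.projection k i, h.orthogonal, h.complete⟩,
      fun h => ⟨fun k i => h.1 k trivial i trivial, h.2.1, h.2.2⟩⟩
  rw [hset]
  refine hK.inter_right (IsClosed.inter ?_ ?_)
  · simp only [Set.ofPred_forall]
    refine isClosed_iInter fun k => isClosed_iInter fun i => isClosed_iInter fun j =>
      isClosed_iInter fun _ => isClosed_eq ?_ continuous_const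
    fun_prop
  · simp only [Set.ofPred_forall]
    refine isClosed_iInter fun k => isClosed_eq ?_ continuous_const
    fun_prop

lemma continuous_projState (i : Fin d) (k : Fin m) :
    Continuous fun P : ∀ k : Fin m, Fin d → Matrix (Fin (n k)) (Fin (n k)) ℂ =>
      S.projState P t i k := by
  unfold projState
  fun_prop

lemma continuous_totalProb :
    Continuous fun P : ∀ k : Fin m, Fin d → Matrix (Fin (n k)) (Fin (n k)) ℂ =>
      S.totalProb P t := by
  unfold totalProb jointProb prob
  refine continuous_finsetSum _ fun i _ => continuous_const.mul (continuous_finsetProd _ fun k _ => ?_)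
  exact Complex.continuous_re.comp (S.continuous_projState t i k).matrix_trace

/-- On the measurements with success probability at least `c > 0`, the distance is minimal
somewhere. -/
lemma exists_isMinOn_sbsDistance {c : ℝ} (hc : 0 < c)
    {P₀ : ∀ k : Fin m, Fin d → Matrix (Fin (n k)) (Fin (n k)) ℂ} (h₀ : IsMeasurement P₀)
    (h₀c : c ≤ S.totalProb P₀ t) :
    ∃ P : ∀ k : Fin m, Fin d → Matrix (Fin (n k)) (Fin (n k)) ℂ, IsMeasurement P ∧
      c ≤ S.totalProb P t ∧
      ∀ P', IsMeasurement P' → c ≤ S.totalProb P' t → S.sbsDistance P t ≤ S.sbsDistance P' t := by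
  have hK : IsCompact ({P : ∀ k : Fin m, Fin d → Matrix (Fin (n k)) (Fin (n k)) ℂ |
      IsMeasurement P} ∩ {P | c ≤ S.totalProb P t}) :=
    isCompact_isMeasurement.inter_right (isClosed_le continuous_const (S.continuous_totalProb t))
  have hcont : ContinuousOn (fun P => S.sbsDistance P t)
      ({P : ∀ k : Fin m, Fin d → Matrix (Fin (n k)) (Fin (n k)) ℂ |
        IsMeasurement P} ∩ {P | c ≤ S.totalProb P t}) := by
    have h1 : ContinuousOn (fun P : ∀ k : Fin m, Fin d → Matrix (Fin (n k)) (Fin (n k)) ℂ =>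
        -- In this form only `totalProb` is divided by, and it is bounded away from zero; the local
        -- probabilities may vanish.
        1 / 2 * traceNorm (S.reducedState t - ∑ i, ((S.σ i / S.totalProb P t : ℝ) : ℂ) •
          (pointer i ⊗ₖ tensor fun k => S.projState P t i k)))
        ({P | IsMeasurement P} ∩ {P | c ≤ S.totalProb P t}) := by
      refine continuousOn_const.mul (Continuous.comp_continuousOn (g := traceNorm)
        continuous_traceNorm ?_)
      refine continuousOn_const.sub (continuousOn_finsetSum _ fun i _ => ?_)
      have h2 : Continuous fun P : ∀ k : Fin m, Fin d → Matrix (Fin (n k)) (Fin (n k)) ℂ =>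
          tensor fun k => S.projState P t i k :=
        continuous_tensor fun k => S.continuous_projState t i k
      have h3 : Continuous fun P : ∀ k : Fin m, Fin d → Matrix (Fin (n k)) (Fin (n k)) ℂ =>
          pointer i ⊗ₖ tensor fun k => S.projState P t i k := by
        refine continuous_matrix fun p q => ?_
        simp only [kroneckerMap_apply]
        exact continuous_const.mul (h2.matrix_elem _ _)
      have h4 : ContinuousOn (fun P : ∀ k : Fin m, Fin d → Matrix (Fin (n k)) (Fin (n k)) ℂ =>
          ((S.σ i / S.totalProb P t : ℝ) : ℂ))
          ({P | IsMeasurement P} ∩ {P | c ≤ S.totalProb P t}) :=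
        Complex.continuous_ofReal.comp_continuousOn (continuousOn_const.div
          (S.continuous_totalProb t).continuousOn fun P hP => (hc.trans_le hP.2).ne')
      exact h4.smul h3.continuousOn
    refine h1.congr fun P hP => ?_
    simp only [sbsDistance, S.sbsState_eq t hP.1]
  obtain ⟨P, hP, hmin⟩ := hK.exists_isMinOn ⟨P₀, h₀, h₀c⟩ hcont
  exact ⟨P, hP.1, hP.2, fun P' h1 h2 => hmin ⟨h1, h2⟩⟩

/-- The minimal distance to the SBS family is attained. -/
lemma exists_isLeast_sbsDistances : ∃ ε, IsLeast (S.sbsDistances t) ε := by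
  by_cases h : ∃ P₀ : ∀ k : Fin m, Fin d → Matrix (Fin (n k)) (Fin (n k)) ℂ,
      IsMeasurement P₀ ∧ 0 < S.totalProb P₀ t ∧ S.sbsDistance P₀ t < 1
  · obtain ⟨P₀, h₀, hp₀, hd₀⟩ := h
    -- With this threshold, a measurement of smaller success probability has distance larger than
    -- that of `P₀`.
    have hc : 0 < 1 - S.sbsDistance P₀ t := by linarith
    have h₀c : 1 - S.sbsDistance P₀ t ≤ S.totalProb P₀ t := by
      linarith [S.one_sub_totalProb_le_sbsDistance t h₀ hp₀]
    obtain ⟨P, hP, hPc, hmin⟩ := S.exists_isMinOn_sbsDistance t hc h₀ h₀c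
    refine ⟨S.sbsDistance P t, ⟨P, hP, hc.trans_le hPc, rfl⟩, ?_⟩
    rintro e ⟨P', hP', hp', rfl⟩
    by_cases h1 : 1 - S.sbsDistance P₀ t ≤ S.totalProb P' t
    · exact hmin P' hP' h1
    · have h2 := hmin P₀ h₀ h₀c
      have h3 := S.one_sub_totalProb_le_sbsDistance t hP' hp'
      linarith
  · push Not at h
    obtain ⟨P, hP, hp⟩ := S.exists_measurement t
    refine ⟨S.sbsDistance P t, ⟨P, hP, hp, rfl⟩, ?_⟩
    rintro e ⟨P', hP', hp', rfl⟩
    exact (S.sbsDistance_le_one t hP hp).trans (h P' hP' hp')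

end Model

end SBS

end

theorem corollary1 {d m l : ℕ} {n : Fin m → ℕ} {n' : Fin l → ℕ}
    (S : SBS.Model d m l n n') (t : ℝ) :
    ∃ ε : ℝ, IsLeast (S.sbsDistances t) ε ∧ ε ≤ S.η t := by
  obtain ⟨ε, hε⟩ := S.exists_isLeast_sbsDistances t
  refine ⟨ε, hε, ?_⟩
  -- For `η ≥ 1` any SBS state will do, since half the trace distance of two states is at most `1`.
  rcases lt_or_ge (S.η t) 1 with h | h
  · obtain ⟨P, hP, hp, hd⟩ := S.exists_sbsDistance_le t h
    exact (hε.2 ⟨P, hP, hp, rfl⟩).trans hd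
  · obtain ⟨P, hP, hp⟩ := S.exists_measurement t
    exact (hε.2 ⟨P, hP, hp, rfl⟩).trans ((S.sbsDistance_le_one t hP hp).trans h)
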